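/- **Setting.** For each $n$ let $P_0=P_0^{(n)}$ be a discrete probability distribution on $\mathbb{R}^n$, and let $X,X'$ be independent draws from $P_0$, with overlap $\langle X,X'\rangle$. - *Quantile.* For $D>0$, $q(D)=\inf\{y\in\mathbb{R}: \mathbb{P}(|\langle X,X'\rangle|\le y)\ge 1-e^{-D}\}$. - *Overlap PMF.* $f_{\mathrm{ov}}(t)=\mathbb{P}(\langle X,X'\rangle=t)$ and $\mathcal{S}_{\mathrm{ov}}=\{t\in\mathbb{R}: f_{\mathrm{ov}}(t)>0\}$. - *Annealed Franz–Parisi potential.* $\mathcal{F}_{\mathrm{ann},\lambda}(q)=-\log\mathbb{E}\big[\mathbf 1_{\langle X,X'\rangle=q}\,e^{\lambda\langle X,X'\rangle}\big]$. - *Difference operator.* $\mathbf{\Delta}_{a}f(q)=\dfrac{f(q+a(q))-f(q)}{a(q)}$, for a step $a(q)>0$ and $q,\ q+a(q)\in\mathcal{S}_{\mathrm{ov}}$. - *Degree-$D$ correlation.* For the Gaussian additive model $Y=\sqrt{\lambda}X+Z$ with $Z\sim N(0,I_n)$ independent of $X\sim P_0$, $$\mathrm{Corr}^{\le D}_{P_0}(\lambda)=\sqrt{\sum_{i=1}^n\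 \sup\big\{\mathbb{E}[g(Y)X_i]^2:\ g\in\mathbb{R}[Y]_{\le D},\ \mathbb{E}[g(Y)^2]=1\big\}} .$$ - *Cumulants.* For a multi-index $\alpha\in\mathbb{N}^n$, $\kappa_\alpha(X_1,\dots,X_n)$ is the joint cumulant of the family containing $\alpha_i$ copies of $X_i$ for each $i$; the joint cumulant of $W_1,\dots,W_m$ is $\sum_{\pi}(-1)^{|\pi|-1}(|\pi|-1)!\prod_{B\in\pi}\mathbb{E}\prod_{j\in B}W_j$ over set partitions $\pi$ of $\{1,\dots,m\}$ (and it is $0$ for the empty family). **Assumptions.** Let $C>0$, let $D_n$ be positive integers with $D_n\le n^C$, let $A_n>0$, and let $a_n$ be step functions. Assume that for all sufficiently large $n$: 0. $q(D_n)\in\mathcal{S}_{\mathrm{ov}}$, $a_n(q(D_n))>0$ and $q(D_n)+a_n(q(D_n))\in\mathcal{S}_{\mathrm{ov}}$; 1. $\kappa_\alpha(X_1,\dots,X_n)\ge 0$ for every $\alpha\in\mathbb{N}^n$ with $|\alpha|\le D_n$; 2. $(\mathbb{E}|X_i|^p)^{1/p}\le K p^{1/\phi}$ for all real $p\ge1$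 and all $i\in[n]$, where $\phi,K>0$ do not depend on $i$ or $n$; 3. $q(D_n(\log n)^2)\ge\max\{(\log n)^{-D_n/2},\,n^{-C_1}\}$, where $C_1>0$ does not depend on $n$; 4. $\displaystyle \mathbf{\Delta}_{a_n}\log f_{\mathrm{ov}}\big|_{q(D_n)}\ \ge\ -\frac{A_n}{q(D_n(\log n)^2)\,\log n}$. Let $D_n'$ be positive integers with $D_n'=(1+o(1))D_n(\log n)^2$, and assume that $q(D_n')\ge n^{-C_2}$ for some constant $C_2>0$ and all sufficiently large $n$ (by 3, this is automatic if $D_n'\ge D_n(\log n)^2$). **Conclusion.** For all sufficiently large $n$, the following hold. - For every $u>0$ with $u+\mathbf{\Delta}_{a_n}\mathcal{F}_{\mathrm{ann},u}\big|_{q(D_n)}>0$, $$\mathrm{Corr}^{\le D_n}_{P_0}\Big(\tfrac1{A_n}\big(u+\mathbf{\Delta}_{a_n}\mathcal{F}_{\mathrm{ann},u}\big|_{q(D_n)}\big)\Big)^2\le 2\,q(D_n').$$ - For every $\lambda>0$, if $\mathbf{\Delta}_{a_n}\mathcal{F}_{\mathrm{ann},\lambda}\big|_{q(D_n)}\ge0$,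 then $\mathrm{Corr}^{\le D_n}_{P_0}(\lambda/A_n)^2\le 2\,q(D_n')$. -/

import Mathlib

open MeasureTheory ProbabilityTheory Filter Topology Asymptotics
open scoped ENNReal

namespace GAM

noncomputable section

/-- Joint cumulant of a finite family `Y` of real random variables on `(Ω, μ)`:
`κ(Y) = ∑_π (-1)^(|π|-1) (|π|-1)! ∏_{B ∈ π} E[∏_{j ∈ B} Y j]`, the sum running over the set
partitions `π` of the index set. This makes sense as soon as all moments are finite, and equals the
mixed derivative of the cumulant generating function at `0` when the latter is finite near `0`.
For an empty family the only partition has no block; it is left out, so the value is `log 1 = 0`. -/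
def jointCumulant {Ω ι : Type*} [MeasurableSpace Ω] [Fintype ι] [DecidableEq ι]
    (μ : Measure Ω) (Y : ι → Ω → ℝ) : ℝ :=
  ∑ π : Finpartition (Finset.univ : Finset ι),
    if π.parts.card = 0 then 0
    else (-1 : ℝ) ^ (π.parts.card - 1) * ((π.parts.card - 1).factorial : ℝ) *
      ∏ B ∈ π.parts, ∫ ω, ∏ j ∈ B, Y j ω ∂μ

/-- `κ_α(X₁, …, X_n)` for `X ∼ μ` and a multi-index `α`: the joint cumulant of the family that
contains `α i` copies of the coordinate `X i`. -/
def cumulant {n : ℕ} (μ : Measure (Fin n → ℝ)) (α : Fin n → ℕ) : ℝ :=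
  jointCumulant μ (fun (j : (i : Fin n) × Fin (α i)) (x : Fin n → ℝ) => x j.1)

/-- `Y` is sub-Weibull of order `φ` with constant `K`: `(E|Y|^p)^(1/p) ≤ K p^(1/φ)` for all
real `p ≥ 1` (in particular these moments are finite). -/
def IsSubWeibull {Ω : Type*} [MeasurableSpace Ω] (φ K : ℝ) (Y : Ω → ℝ) (μ : Measure Ω) : Prop :=
  ∀ p : ℝ, 1 ≤ p → eLpNorm Y (ENNReal.ofReal p) μ ≤ ENNReal.ofReal (K * p ^ (1 / φ))

/-- The law of two independent draws `(X, X')` from `μ`. -/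
def replicas {n : ℕ} (μ : Measure (Fin n → ℝ)) : Measure ((Fin n → ℝ) × (Fin n → ℝ)) :=
  μ.prod μ

/-- The overlap `⟨X, X'⟩ = ∑ i, X i * X' i`. -/
def overlap {n : ℕ} (z : (Fin n → ℝ) × (Fin n → ℝ)) : ℝ :=
  ∑ i, z.1 i * z.2 i

/-- The quantile `q(D) = inf {y | P(|⟨X, X'⟩| ≤ y) ≥ 1 - e^(-D)}`, for `D > 0`. -/
def quantile {n : ℕ} (μ : Measure (Fin n → ℝ)) (D : ℝ) : ℝ :=
  sInf {y : ℝ | 1 - Real.exp (-D) ≤ (replicas μ).real {z | |overlap z| ≤ y}}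

/-- The probability mass function `f_ov(t) = P(⟨X, X'⟩ = t)` of the overlap. -/
def overlapPMF {n : ℕ} (μ : Measure (Fin n → ℝ)) (t : ℝ) : ℝ :=
  (replicas μ).real {z | overlap z = t}

/-- `S_ov = {t | f_ov(t) > 0}`. -/
def overlapSupport {n : ℕ} (μ : Measure (Fin n → ℝ)) : Set ℝ :=
  {t | 0 < overlapPMF μ t}

/-- The annealed Franz-Parisi potential
`F_ann,lam(q) = - log E[1{⟨X, X'⟩ = q} exp(lam ⟨X, X'⟩)]`. -/
def annealedFP {n : ℕ} (μ : Measure (Fin n → ℝ)) (lam q : ℝ) : ℝ :=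
  - Real.log (∫ z, Set.indicator {z | overlap z = q} (fun z => Real.exp (lam * overlap z)) z
      ∂(replicas μ))

/-- The discrete difference operator `Δ_a f (q) = (f(q + a(q)) - f(q)) / a(q)`. It is only used at
points with `a(q) > 0` and with `q`, `q + a(q)` in the support of the overlap. -/
def discreteDeriv (a : ℝ → ℝ) (f : ℝ → ℝ) (q : ℝ) : ℝ :=
  (f (q + a q) - f q) / a q

/-- The law of `(X, Z)` with `X ∼ μ` and `Z ∼ N(0, I_n)` independent. -/
def signalNoise {n : ℕ} (μ : Measure (Fin n → ℝ)) : Measure ((Fin n → ℝ) × (Fin n → ℝ)) :=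
  μ.prod (Measure.pi fun _ => gaussianReal 0 1)

/-- The observation `Y = √lam X + Z` of the Gaussian additive model with signal-to-noise
ratio `lam`. -/
def observation {n : ℕ} (lam : ℝ) (w : (Fin n → ℝ) × (Fin n → ℝ)) : Fin n → ℝ :=
  fun i => Real.sqrt lam * w.1 i + w.2 i

/-- The degree-`D` correlation
`Corr^{≤D}(lam) = √(∑ i, sup {E[g(Y) X_i]² : g polynomial, deg g ≤ D, E[g(Y)²] = 1})`. -/
def corr {n : ℕ} (μ : Measure (Fin n → ℝ)) (D : ℕ) (lam : ℝ) : ℝ :=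
  Real.sqrt (∑ i : Fin n, sSup {r : ℝ | ∃ g : MvPolynomial (Fin n) ℝ, g.totalDegree ≤ D ∧
    ∫ w, (MvPolynomial.eval (observation lam w) g) ^ 2 ∂(signalNoise μ) = 1 ∧
    r = (∫ w, MvPolynomial.eval (observation lam w) g * w.1 i ∂(signalNoise μ)) ^ 2})

/-- A sequence of discrete priors `P n` on `ℝ^n` is low-order cumulant-nonnegative with parameters
`D`, `A`, `a`, `C`. -/
structure CumulantNonneg (P : (n : ℕ) → PMF (Fin n → ℝ)) (D : ℕ → ℕ) (A : ℕ → ℝ)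
    (a : ℕ → ℝ → ℝ) (C : ℝ) : Prop where
  C_pos : 0 < C
  D_pos : ∀ n, 0 < D n
  D_le : ∀ᶠ n : ℕ in atTop, (D n : ℝ) ≤ (n : ℝ) ^ C
  A_pos : ∀ n, 0 < A n
  /-- The operator `Δ_{a n}` can be evaluated at `q(D n)`. -/
  step : ∀ᶠ n : ℕ in atTop,
    quantile (P n).toMeasure (D n) ∈ overlapSupport (P n).toMeasure ∧
    0 < a n (quantile (P n).toMeasure (D n)) ∧
    quantile (P n).toMeasure (D n) + a n (quantile (P n).toMeasure (D n)) ∈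
      overlapSupport (P n).toMeasure
  /-- Cumulants of order at most `D n` are nonnegative. -/
  cumulant_nonneg : ∀ᶠ n : ℕ in atTop, ∀ α : Fin n → ℕ, ∑ i, α i ≤ D n →
    0 ≤ cumulant (P n).toMeasure α
  /-- Polynomial growth of the marginal moments, uniformly in the coordinate and in `n`. -/
  subWeibull : ∃ φ > 0, ∃ K > 0, ∀ᶠ n : ℕ in atTop, ∀ i : Fin n,
    IsSubWeibull φ K (fun x : Fin n → ℝ => x i) (P n).toMeasure
  /-- Controlled decay of the overlap quantiles. -/
  quantile_decay : ∃ C₁ : ℝ, 0 < C₁ ∧ ∀ᶠ n : ℕ in atTop,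
    max (Real.log n ^ (-(D n : ℝ) / 2)) ((n : ℝ) ^ (-C₁)) ≤
      quantile (P n).toMeasure (D n * Real.log n ^ 2)
  /-- Quantile stability. -/
  quantile_stability : ∀ᶠ n : ℕ in atTop,
    - (A n / (quantile (P n).toMeasure (D n * Real.log n ^ 2) * Real.log n)) ≤
      discreteDeriv (a n) (fun t => Real.log (overlapPMF (P n).toMeasure t))
        (quantile (P n).toMeasure (D n))

end

end GAM

/-
The joint cumulants of `(X_i, X)` are the coefficients of a dual certificate: a combination of
Hermite polynomials in the noise `Z` that correlates with every polynomial of degree at most `D`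
in `Y = √λ X + Z` exactly as `X_i` does. By Cauchy–Schwarz, `Corr²` is at most a sum of
`κ² λ^|β| / β!` over multi-indices. Because the low-order cumulants are nonnegative, each cumulant
is at most the corresponding moment, so the degree-`k` part of the sum is controlled by the `k`-th
overlap moment. Truncating the overlap at its quantile `q(T)`, with `T` of order `D log² n`, bounds
these moments by powers of `q(T)` up to a negligible tail, and the sum is dominated by its first
term as soon as `λ q` is small. Finally `u + Δ F_{ann,u} = -Δ log f_ov`, so quantile stability is
exactly the statement that the signal-to-noise ratios of the theorem are this small.
-/

namespace GAM

noncomputable section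

section PartitionCumulant

variable {ι κ R : Type*} [DecidableEq ι] [DecidableEq κ] [CommRing R]

/-- The Möbius function of the lattice of set partitions, evaluated between a partition with `k`
blocks and the one-block partition; `0` for `k = 0`, so that the empty family has cumulant `0`. -/
def cumulantCoeff (R : Type*) [CommRing R] : ℕ → R
  | 0 => 0
  | k + 1 => (-1) ^ k * (k.factorial : R)

theorem cumulantCoeff_succ_add_nsmul (k : ℕ) :
    cumulantCoeff R (k + 1) + k • cumulantCoeff R k = if k = 0 then 1 else 0 := by
  rcases k with _ | k
  · simp [cumulantCoeff]
  · simp only [cumulantCoeff, Nat.factorial_succ, pow_succ, nsmul_eq_mul, Nat.succ_ne_zero,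
      if_false]
    push_cast
    ring

/-- The cumulants of an abstract moment functional: `M B` plays the role of the mixed moment of
the variables indexed by `B`. -/
def partitionCumulant (M : Finset ι → R) (S : Finset ι) : R :=
  ∑ π : Finpartition S, cumulantCoeff R π.parts.card * ∏ B ∈ π.parts, M B

theorem parts_avoid_of_mem {S C : Finset ι} {σ : Finpartition S} (hC : C ∈ σ.parts) :
    (σ.avoid C).parts = σ.parts.erase C := by
  ext B
  rw [Finpartition.mem_avoid, Finset.mem_erase]
  constructor
  · rintro ⟨B, hB, hBC, rfl⟩
    have hne : B ≠ C := fun h => hBC h.le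
    have hdisj : Disjoint B C := σ.disjoint hB hC hne
    rw [Finset.sdiff_eq_self_of_disjoint hdisj]
    exact ⟨hne, hB⟩
  · rintro ⟨hne, hB⟩
    have hdisj : Disjoint B C := σ.disjoint hB hC hne
    exact ⟨B, hB, fun hle => σ.ne_bot hB (disjoint_self.1 (hdisj.mono_right hle)),
      Finset.sdiff_eq_self_of_disjoint hdisj⟩

theorem notMem_parts_sdiff {S C : Finset ι} (hC : C.Nonempty) (π : Finpartition (S \ C)) :
    C ∉ π.parts := fun h => by
  obtain ⟨x, hx⟩ := hC
  exact (Finset.mem_sdiff.1 (π.subset h hx)).2 hx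

theorem exists_mem_parts_avoid_eq {S C : Finset ι} (hC : C.Nonempty) (hCS : C ⊆ S)
    (π : Finpartition (S \ C)) : ∃ σ : Finpartition S, C ∈ σ.parts ∧ σ.avoid C = π := by
  let σ : Finpartition S :=
    π.extend hC.ne_empty Finset.sdiff_disjoint (Finset.sdiff_union_of_subset hCS)
  have hσ : C ∈ σ.parts := Finset.mem_insert_self _ _
  refine ⟨σ, hσ, Finpartition.ext ?_⟩
  rw [parts_avoid_of_mem hσ]
  exact Finset.erase_insert (notMem_parts_sdiff hC π)

theorem card_parts_filter_notMem {S : Finset ι} (σ : Finpartition S) {j : ι} (hj : j ∈ S) :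
    (σ.parts.filter (j ∉ ·)).card = σ.parts.card - 1 := by
  have hpart : σ.parts.filter (j ∉ ·) = σ.parts.erase (σ.part j) := by
    ext B
    simp only [Finset.mem_filter, Finset.mem_erase]
    exact ⟨fun ⟨hB, hjB⟩ => ⟨fun h => hjB (h ▸ σ.mem_part_self.2 hj), hB⟩,
      fun ⟨hne, hB⟩ => ⟨hB, fun h => hne (σ.part_eq_of_mem hB h).symm⟩⟩
  rw [hpart, Finset.card_erase_of_mem (σ.part_mem.2 hj)]

theorem sum_sum_insert_parts {S : Finset ι} {j : ι} (hj : j ∈ S) (F : Finset (Finset ι) → R) :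
    ∑ C ∈ (S.erase j).powerset.erase ∅, ∑ π : Finpartition (S \ C), F (insert C π.parts) =
      ∑ σ : Finpartition S, (σ.parts.card - 1) • F σ.parts := by
  simp_rw [← card_parts_filter_notMem _ hj, ← Finset.sum_const]
  rw [Finset.sum_sigma', Finset.sum_sigma']
  symm
  refine Finset.sum_nbij (fun p => ⟨p.2, p.1.avoid p.2⟩) ?_ ?_ ?_ ?_
  · rintro ⟨σ, C⟩ hC
    obtain ⟨hCσ, hjC⟩ : C ∈ σ.parts ∧ j ∉ C := by simpa using hC
    simp [Finset.subset_erase, σ.subset hCσ, hjC, (σ.nonempty_of_mem_parts hCσ).ne_empty]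
  · rintro ⟨σ, C⟩ hC ⟨σ', C'⟩ hC' h
    obtain ⟨hCσ, -⟩ : C ∈ σ.parts ∧ j ∉ C := by simpa using hC
    obtain ⟨hCσ', -⟩ : C' ∈ σ'.parts ∧ j ∉ C' := by simpa using hC'
    obtain rfl : C = C' := congrArg Sigma.fst h
    have havoid : σ.avoid C = σ'.avoid C := by simpa using h
    have hparts : σ.parts.erase C = σ'.parts.erase C := by
      rw [← parts_avoid_of_mem hCσ, havoid, parts_avoid_of_mem hCσ']
    obtain rfl : σ = σ' := Finpartition.ext <| by
      rw [← Finset.insert_erase hCσ, hparts, Finset.insert_erase hCσ']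
    rfl
  · rintro ⟨C, π⟩ hC
    rw [Finset.mem_coe] at hC
    obtain ⟨hne, hCS, hjC⟩ : C ≠ ∅ ∧ C ⊆ S ∧ j ∉ C := by simpa [Finset.subset_erase] using hC
    obtain ⟨σ, hCσ, rfl⟩ :=
      exists_mem_parts_avoid_eq (Finset.nonempty_iff_ne_empty.2 hne) hCS π
    exact ⟨⟨σ, C⟩, by simp [hCσ, hjC], rfl⟩
  · rintro ⟨σ, C⟩ hC
    obtain ⟨hCσ, -⟩ : C ∈ σ.parts ∧ j ∉ C := by simpa using hC
    simp only [parts_avoid_of_mem hCσ, Finset.insert_erase hCσ]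

theorem sum_ite_card_parts_eq_one {S : Finset ι} (hS : S.Nonempty) (M : Finset ι → R) :
    ∑ σ : Finpartition S, (if σ.parts.card = 1 then 1 else 0) * ∏ B ∈ σ.parts, M B = M S := by
  rw [Finset.sum_eq_single (Finpartition.indiscrete hS.ne_empty)]
  · simp
  · intro σ _ hσ
    rw [if_neg, zero_mul]
    intro hcard
    obtain ⟨B, hB⟩ := Finset.card_eq_one.1 hcard
    have hBS : B = S := by simpa [hB] using σ.sup_parts
    exact hσ (Finpartition.ext (by simp [hB, hBS]))
  · simp

theorem eq_sum_partitionCumulant_mul {M : Finset ι → R} (hM : M ∅ = 1) {S : Finset ι} {j : ι}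
    (hj : j ∈ S) :
    M S = ∑ C ∈ (S.erase j).powerset, partitionCumulant M (S \ C) * M C := by
  let F : Finset (Finset ι) → R := fun p => cumulantCoeff R (p.card - 1) * ∏ B ∈ p, M B
  have hF : ∀ C ∈ (S.erase j).powerset.erase ∅, partitionCumulant M (S \ C) * M C =
      ∑ π : Finpartition (S \ C), F (insert C π.parts) := by
    intro C hC
    rw [partitionCumulant, Finset.sum_mul]
    refine Finset.sum_congr rfl fun π _ => ?_
    have hCπ := notMem_parts_sdiff (Finset.nonempty_iff_ne_empty.2 (Finset.ne_of_mem_erase hC)) π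
    simp only [F, Finset.card_insert_of_notMem hCπ, Finset.prod_insert hCπ, Nat.add_sub_cancel]
    ring
  rw [← Finset.add_sum_erase _ _ (Finset.empty_mem_powerset _), hM, mul_one, Finset.sdiff_empty,
    Finset.sum_congr rfl hF, sum_sum_insert_parts hj, partitionCumulant, ← Finset.sum_add_distrib,
    ← sum_ite_card_parts_eq_one ⟨j, hj⟩ M]
  refine Finset.sum_congr rfl fun σ _ => ?_
  obtain ⟨k, hk⟩ : ∃ k, σ.parts.card = k + 1 := Nat.exists_eq_succ_of_ne_zero
    (Finset.card_pos.2 (σ.parts_nonempty (Finset.ne_empty_of_mem hj))).ne'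
  have hcoeff := cumulantCoeff_succ_add_nsmul (R := R) k
  simp only [F, hk, Nat.add_sub_cancel, Nat.add_eq_right, ← hcoeff, nsmul_eq_mul]
  ring

theorem eq_partitionCumulant_of_recursion {M K : Finset ι → R} (hM : M ∅ = 1)
    (hK : ∀ S, ∀ j ∈ S, M S = ∑ C ∈ (S.erase j).powerset, K (S \ C) * M C)
    {S : Finset ι} (hS : S.Nonempty) : K S = partitionCumulant M S := by
  induction S using Finset.strongInduction with
  | H S ih =>
    obtain ⟨j, hj⟩ := hS
    have hrec := (hK S j hj).symm.trans (eq_sum_partitionCumulant_mul hM hj)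
    rw [← Finset.add_sum_erase _ _ (Finset.empty_mem_powerset _),
      ← Finset.add_sum_erase _ _ (Finset.empty_mem_powerset _), hM, mul_one, mul_one,
      Finset.sdiff_empty] at hrec
    refine add_right_cancel (hrec.trans (congrArg _ (Finset.sum_congr rfl fun C hC => ?_)))
    obtain ⟨hne, hCS, hjC⟩ : C ≠ ∅ ∧ C ⊆ S ∧ j ∉ C := by simpa [Finset.subset_erase] using hC
    rw [ih (S \ C) (Finset.sdiff_ssubset hCS (Finset.nonempty_iff_ne_empty.2 hne))
      ⟨j, Finset.mem_sdiff.2 ⟨hj, hjC⟩⟩]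

theorem partitionCumulant_map {M : Finset κ → R} (hM : M ∅ = 1) (f : ι ↪ κ) {S : Finset ι}
    (hS : S.Nonempty) :
    partitionCumulant M (S.map f) = partitionCumulant (fun T => M (T.map f)) S := by
  refine eq_partitionCumulant_of_recursion (K := fun T => partitionCumulant M (T.map f))
    (by simpa using hM) (fun T j hj => ?_) hS
  have hpow : ((T.map f).erase (f j)).powerset =
      (T.erase j).powerset.map (Finset.mapEmbedding f).toEmbedding := by
    ext C
    simp [← Finset.map_erase, Finset.subset_map_iff, eq_comm]
  rw [eq_sum_partitionCumulant_mul hM (Finset.mem_map_of_mem f hj), hpow, Finset.sum_map]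
  refine Finset.sum_congr rfl fun C _ => ?_
  rw [RelEmbedding.coe_toEmbedding, Finset.mapEmbedding_apply, ← Finset.map_sdiff]

theorem jointCumulant_eq_partitionCumulant {Ω : Type*} [MeasurableSpace Ω] [Fintype ι]
    (μ : Measure Ω) (Y : ι → Ω → ℝ) :
    jointCumulant μ Y = partitionCumulant (fun B => ∫ ω, ∏ j ∈ B, Y j ω ∂μ) Finset.univ := by
  refine Finset.sum_congr rfl fun π _ => ?_
  cases π.parts.card <;> simp [cumulantCoeff]

end PartitionCumulant

section ColorCount

variable {ι κ : Type*} [DecidableEq κ]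

/-- The multi-index counting the elements of `B` of each color, under the coloring `c`. -/
def colorCount (c : ι → κ) (B : Finset ι) (k : κ) : ℕ :=
  (B.filter (c · = k)).card

/-- The multi-index binomial coefficient `α choose γ`. -/
def piChoose [Fintype κ] (α γ : κ → ℕ) : ℕ :=
  ∏ k, (α k).choose (γ k)

theorem colorCount_mono (c : ι → κ) {B C : Finset ι} (h : C ⊆ B) :
    colorCount c C ≤ colorCount c B :=
  fun _ => Finset.card_le_card (Finset.filter_subset_filter _ h)

theorem colorCount_sdiff [DecidableEq ι] (c : ι → κ) {B C : Finset ι} (h : C ⊆ B) :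
    colorCount c (B \ C) = colorCount c B - colorCount c C := by
  funext k
  have hfilter : (B \ C).filter (c · = k) = B.filter (c · = k) \ C.filter (c · = k) := by
    grind
  rw [colorCount, hfilter, Finset.card_sdiff_of_subset (Finset.filter_subset_filter _ h)]
  rfl

theorem colorCount_singleton (c : ι → κ) (j : ι) : colorCount c {j} = Pi.single (c j) 1 := by
  funext k
  rcases eq_or_ne (c j) k with rfl | hk
  · simp [colorCount, Finset.filter_singleton]
  · simp [colorCount, Finset.filter_singleton, hk, hk.symm]

theorem exists_embedding_of_colorCount (c : ι → κ) (B : Finset ι) [Fintype κ] :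
    ∃ f : (Σ k, Fin (colorCount c B k)) ↪ ι, Finset.univ.map f = B ∧ ∀ t, c (f t) = t.1 := by
  let f : (Σ k, Fin (colorCount c B k)) → ι := fun t =>
    (B.filter (c · = t.1)).equivFin.symm t.2
  have hf : ∀ t, f t ∈ B ∧ c (f t) = t.1 := fun t =>
    Finset.mem_filter.1 ((B.filter (c · = t.1)).equivFin.symm t.2).2
  have hinj : Function.Injective f := by
    rintro ⟨k, l⟩ ⟨k', l'⟩ h
    obtain rfl : k = k' := (hf ⟨k, l⟩).2.symm.trans ((congrArg c h).trans (hf ⟨k', l'⟩).2)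
    exact congrArg _ ((B.filter (c · = k)).equivFin.symm.injective (Subtype.ext h))
  refine ⟨⟨f, hinj⟩, ?_, fun t => (hf t).2⟩
  ext x
  simp only [Finset.mem_map, Finset.mem_univ, true_and, Function.Embedding.coeFn_mk]
  constructor
  · rintro ⟨t, rfl⟩
    exact (hf t).1
  · intro hx
    refine ⟨⟨c x, (B.filter (c · = c x)).equivFin ⟨x, by simp [hx]⟩⟩, ?_⟩
    simp [f]

theorem colorCount_sigma_fst_univ [Fintype κ] (α : κ → ℕ) :
    colorCount (Sigma.fst : (Σ k, Fin (α k)) → κ) Finset.univ = α := by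
  funext k
  have hfiber : Finset.univ.filter (fun t : Σ k, Fin (α k) => t.1 = k) =
      Finset.univ.map (Function.Embedding.sigmaMk k) := by
    ext ⟨k', l⟩
    simp only [Finset.mem_filter, Finset.mem_univ, true_and, Finset.mem_map,
      Function.Embedding.sigmaMk_apply]
    constructor
    · rintro rfl
      exact ⟨l, rfl⟩
    · rintro ⟨l', h⟩
      exact (congrArg Sigma.fst h).symm
  rw [colorCount, hfiber, Finset.card_map, Finset.card_univ, Fintype.card_fin]

theorem prod_comp_eq_prod_pow_colorCount [Fintype κ] {R : Type*} [CommMonoid R] (c : ι → κ)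
    (B : Finset ι) (x : κ → R) : ∏ t ∈ B, x (c t) = ∏ k, x k ^ colorCount c B k := by
  simp only [colorCount, ← Finset.prod_const, Finset.prod_fiberwise']

theorem filter_biUnion_eq_of_subset_fibers [Fintype κ] [DecidableEq ι] {c : ι → κ} {B : Finset ι}
    {t : κ → Finset ι} (ht : ∀ k, t k ⊆ B.filter (c · = k)) (k : κ) :
    (Finset.univ.biUnion t).filter (c · = k) = t k := by
  ext x
  have hx : ∀ k', x ∈ t k' → c x = k' := fun k' h => (Finset.mem_filter.1 (ht k' h)).2
  simp only [Finset.mem_filter, Finset.mem_biUnion, Finset.mem_univ, true_and]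
  exact ⟨fun ⟨⟨k', hk'⟩, hc⟩ => (hx k' hk').symm.trans hc ▸ hk', fun h => ⟨⟨k, h⟩, hx k h⟩⟩

theorem card_filter_powerset_colorCount [Fintype κ] (c : ι → κ) (B : Finset ι)
    (γ : κ → ℕ) :
    (B.powerset.filter (colorCount c · = γ)).card = piChoose (colorCount c B) γ := by
  classical
  have hcard : piChoose (colorCount c B) γ =
      (Fintype.piFinset fun k => (B.filter (c · = k)).powersetCard (γ k)).card := by
    simp [piChoose, colorCount, Fintype.card_piFinset]
  rw [hcard]
  refine Finset.card_nbij' (fun C k => C.filter (c · = k)) (fun t => Finset.univ.biUnion t)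
    ?_ ?_ ?_ ?_
  · intro C hC
    obtain ⟨hCB, rfl⟩ : C ⊆ B ∧ colorCount c C = γ := by simpa using hC
    simp [Finset.mem_powersetCard, Finset.filter_subset_filter, hCB, colorCount]
  · intro t ht
    have ht' : ∀ k, t k ⊆ B.filter (c · = k) ∧ (t k).card = γ k := by
      simpa [Finset.mem_powersetCard] using ht
    simp only [Finset.coe_filter, Finset.mem_powerset, Set.mem_ofPred_eq]
    refine ⟨Finset.biUnion_subset.2 fun k _ => (ht' k).1.trans (Finset.filter_subset _ _), ?_⟩
    funext k
    rw [colorCount, filter_biUnion_eq_of_subset_fibers (fun k => (ht' k).1), (ht' k).2]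
  · intro C _
    ext x
    simp
  · intro t ht
    have ht' : ∀ k, t k ⊆ B.filter (c · = k) ∧ (t k).card = γ k := by
      simpa [Finset.mem_powersetCard] using ht
    exact funext fun k => filter_biUnion_eq_of_subset_fibers (fun k => (ht' k).1) k

theorem sum_powerset_colorCount [Fintype κ] {R : Type*} [Semiring R] (c : ι → κ)
    (B : Finset ι) (F : (κ → ℕ) → R) :
    ∑ C ∈ B.powerset, F (colorCount c C) =
      ∑ γ ∈ Finset.Iic (colorCount c B), piChoose (colorCount c B) γ * F γ := by
  classical
  rw [← Finset.sum_fiberwise_of_maps_to (g := colorCount c) fun C hC =>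
    Finset.mem_Iic.2 (colorCount_mono c (Finset.mem_powerset.1 hC))]
  refine Finset.sum_congr rfl fun γ _ => ?_
  rw [Finset.sum_congr rfl fun C hC => congrArg F (Finset.mem_filter.1 hC).2, Finset.sum_const,
    card_filter_powerset_colorCount, nsmul_eq_mul]

end ColorCount

section MomentRecursion

variable {n : ℕ}

/-- The moment `E[X^α]`. -/
def moment (μ : Measure (Fin n → ℝ)) (α : Fin n → ℕ) : ℝ :=
  ∫ x, ∏ i, x i ^ α i ∂μ

theorem integral_prod_eq_moment {ι : Type*} (μ : Measure (Fin n → ℝ)) (c : ι → Fin n)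
    (B : Finset ι) : ∫ x, ∏ t ∈ B, x (c t) ∂μ = moment μ (colorCount c B) := by
  simp only [prod_comp_eq_prod_pow_colorCount, moment]

theorem partitionCumulant_integral_prod {ι : Type*} [DecidableEq ι] (μ : Measure (Fin n → ℝ))
    [IsProbabilityMeasure μ] (c : ι → Fin n) {B : Finset ι} (hB : B.Nonempty) :
    partitionCumulant (fun T => ∫ x, ∏ t ∈ T, x (c t) ∂μ) B = cumulant μ (colorCount c B) := by
  obtain ⟨f, hfB, hfc⟩ := exists_embedding_of_colorCount c B
  conv_lhs => rw [← hfB]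
  rw [partitionCumulant_map (by simp) f (Finset.map_nonempty.1 (hfB ▸ hB)), cumulant,
    jointCumulant_eq_partitionCumulant]
  simp only [Finset.prod_map, hfc]

theorem moment_add_single (μ : Measure (Fin n → ℝ)) [IsProbabilityMeasure μ] (α : Fin n → ℕ)
    (i : Fin n) :
    moment μ (α + Pi.single i 1) = ∑ γ ∈ Finset.Iic α,
      piChoose α γ * (cumulant μ (α - γ + Pi.single i 1) * moment μ γ) := by
  let c : (Σ k, Fin ((α + Pi.single i 1 : Fin n → ℕ) k)) → Fin n := Sigma.fst
  have huniv : colorCount c Finset.univ = α + Pi.single i 1 := colorCount_sigma_fst_univ _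
  let j : Σ k, Fin ((α + Pi.single i 1 : Fin n → ℕ) k) := ⟨i, ⟨0, by simp⟩⟩
  have herase : colorCount c (Finset.univ.erase j) = α := by
    rw [Finset.erase_eq, colorCount_sdiff c (Finset.subset_univ _), colorCount_singleton, huniv]
    exact add_tsub_cancel_right α _
  have hterm : ∀ C ∈ (Finset.univ.erase j).powerset,
      partitionCumulant (fun T => ∫ x, ∏ t ∈ T, x (c t) ∂μ) (Finset.univ \ C) *
        ∫ x, ∏ t ∈ C, x (c t) ∂μ =
      cumulant μ (α - colorCount c C + Pi.single i 1) * moment μ (colorCount c C) := by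
    intro C hC
    have hCj := Finset.mem_powerset.1 hC
    have hle : colorCount c C ≤ α := (colorCount_mono c hCj).trans herase.le
    rw [partitionCumulant_integral_prod μ c
      ⟨j, by simpa using fun h => Finset.notMem_erase j _ (hCj h)⟩, integral_prod_eq_moment,
      colorCount_sdiff c (Finset.subset_univ C), huniv, tsub_add_eq_add_tsub hle]
  have hsum := sum_powerset_colorCount c (Finset.univ.erase j)
    fun γ => cumulant μ (α - γ + Pi.single i 1) * moment μ γ
  rw [herase] at hsum
  rw [← huniv, ← integral_prod_eq_moment, eq_sum_partitionCumulant_mul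
    (M := fun T => ∫ x, ∏ t ∈ T, x (c t) ∂μ) (by simp) (Finset.mem_univ j),
    Finset.sum_congr rfl hterm, hsum]

end MomentRecursion

section AllMoments

variable {Ω : Type*} [MeasurableSpace Ω] {μ : Measure Ω} {f g : Ω → ℝ}

/-- `f` has finite absolute moments of all orders. -/
def AllMoments (f : Ω → ℝ) (μ : Measure Ω) : Prop :=
  ∀ p : ℝ≥0∞, p ≠ ∞ → MemLp f p μ

namespace AllMoments

theorem integrable (hf : AllMoments f μ) : Integrable f μ :=
  memLp_one_iff_integrable.1 (hf 1 ENNReal.one_ne_top)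

theorem memLp_two (hf : AllMoments f μ) : MemLp f 2 μ :=
  hf 2 ENNReal.ofNat_ne_top

theorem const [IsFiniteMeasure μ] (c : ℝ) : AllMoments (fun _ : Ω => c) μ :=
  fun _ _ => memLp_const c

theorem add (hf : AllMoments f μ) (hg : AllMoments g μ) : AllMoments (fun x => f x + g x) μ :=
  fun p hp => (hf p hp).add (hg p hp)

theorem mul (hf : AllMoments f μ) (hg : AllMoments g μ) : AllMoments (fun x => f x * g x) μ := by
  intro p hp
  have hp2 : p * 2 ≠ ∞ := ENNReal.mul_ne_top hp ENNReal.ofNat_ne_top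
  have : ENNReal.HolderTriple (p * 2) (p * 2) p := by
    constructor
    rw [ENNReal.mul_inv (Or.inr (by simp)) (Or.inr (by simp)), ← mul_add,
      ENNReal.inv_two_add_inv_two, mul_one]
  exact (hg (p * 2) hp2).mul' (hf (p * 2) hp2)

theorem const_mul (hf : AllMoments f μ) (c : ℝ) : AllMoments (fun x => c * f x) μ :=
  fun p hp => (hf p hp).const_mul c

theorem pow [IsFiniteMeasure μ] (hf : AllMoments f μ) (k : ℕ) :
    AllMoments (fun x => f x ^ k) μ := by
  induction k with
  | zero => simpa using const (μ := μ) 1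
  | succ k ih => simpa only [pow_succ] using ih.mul hf

theorem abs (hf : AllMoments f μ) : AllMoments (fun x => |f x|) μ :=
  fun p hp => (hf p hp).abs

theorem sum {ι : Type*} {F : ι → Ω → ℝ} (s : Finset ι) (hF : ∀ i ∈ s, AllMoments (F i) μ) :
    AllMoments (fun x => ∑ i ∈ s, F i x) μ :=
  fun p hp => memLp_finsetSum s fun i hi => hF i hi p hp

theorem prod [IsFiniteMeasure μ] {ι : Type*} {F : ι → Ω → ℝ} (s : Finset ι)
    (hF : ∀ i ∈ s, AllMoments (F i) μ) : AllMoments (fun x => ∏ i ∈ s, F i x) μ := by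
  classical
  induction s using Finset.induction_on with
  | empty => simpa using const (μ := μ) 1
  | insert a s ha ih =>
    simp only [Finset.prod_insert ha]
    exact (hF a (Finset.mem_insert_self a s)).mul
      (ih fun i hi => hF i (Finset.mem_insert_of_mem hi))

theorem polynomial [IsFiniteMeasure μ] (hf : AllMoments f μ) (p : Polynomial ℝ) :
    AllMoments (fun x => p.eval (f x)) μ := by
  simp only [Polynomial.eval_eq_sum_range]
  exact sum _ fun i _ => (hf.pow i).const_mul _

theorem mvPolynomial [IsFiniteMeasure μ] {σ : Type*} {F : σ → Ω → ℝ}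
    (hF : ∀ i, AllMoments (F i) μ) (p : MvPolynomial σ ℝ) :
    AllMoments (fun x => MvPolynomial.eval (fun i => F i x) p) μ := by
  simp only [MvPolynomial.eval_eq]
  exact sum _ fun d _ => (prod _ fun i _ => (hF i).pow _).const_mul _

theorem comp_measurePreserving {Ω' : Type*} [MeasurableSpace Ω'] {ν : Measure Ω'}
    (hf : AllMoments f μ) {T : Ω' → Ω} (hT : MeasurePreserving T ν μ) :
    AllMoments (fun x => f (T x)) ν :=
  fun p hp => (hf p hp).comp_measurePreserving hT

end AllMoments

theorem sq_integral_mul_le (hf : MemLp f 2 μ) (hg : MemLp g 2 μ) :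
    (∫ x, f x * g x ∂μ) ^ 2 ≤ (∫ x, f x ^ 2 ∂μ) * ∫ x, g x ^ 2 ∂μ := by
  have hfg : Integrable (fun x => f x * g x) μ := hf.integrable_mul hg
  have hquad : ∀ t : ℝ, 0 ≤ (∫ x, f x ^ 2 ∂μ) * (t * t) + 2 * (∫ x, f x * g x ∂μ) * t +
      ∫ x, g x ^ 2 ∂μ := by
    intro t
    have hexpand : ∫ x, (t * f x + g x) ^ 2 ∂μ = (∫ x, f x ^ 2 ∂μ) * (t * t) +
        2 * (∫ x, f x * g x ∂μ) * t + ∫ x, g x ^ 2 ∂μ := by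
      have hsq : ∀ x, (t * f x + g x) ^ 2 =
          t * t * f x ^ 2 + 2 * t * (f x * g x) + g x ^ 2 := fun x => by ring
      simp only [hsq]
      rw [integral_add (f := fun x => t * t * f x ^ 2 + 2 * t * (f x * g x))
        ((hf.integrable_sq.const_mul _).add (hfg.const_mul _)) hg.integrable_sq,
        integral_add (hf.integrable_sq.const_mul _) (hfg.const_mul _), integral_const_mul,
        integral_const_mul]
      ring
    exact hexpand ▸ integral_nonneg fun x => sq_nonneg _
  have hdiscrim := discrim_le_zero hquad
  simp only [discrim] at hdiscrim
  linarith

end AllMoments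

section Hermite

open Polynomial

theorem exists_eq_sum_smul_of_mem_span_image {R M ι : Type*} [Semiring R] [AddCommMonoid M]
    [Module R M] {v : ι → M} {s : Finset ι} {x : M} (hx : x ∈ Submodule.span R (v '' s)) :
    ∃ c : ι → R, x = ∑ i ∈ s, c i • v i := by
  obtain ⟨l, hl, rfl⟩ := (Finsupp.mem_span_image_iff_linearCombination R).1 hx
  exact ⟨l, Finsupp.linearCombination_apply_of_mem_supported R hl⟩

/-- The probabilists' Hermite polynomials over `ℝ`. -/
def hermiteReal (m : ℕ) : ℝ[X] := (hermite m).map (Int.castRingHom ℝ)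

theorem hermiteReal_zero : hermiteReal 0 = 1 := by simp [hermiteReal]

theorem hermiteReal_succ (m : ℕ) :
    hermiteReal (m + 1) = X * hermiteReal m - derivative (hermiteReal m) := by
  simp [hermiteReal, hermite_succ, derivative_map]

theorem derivative_hermiteReal_succ (m : ℕ) :
    derivative (hermiteReal (m + 1)) = C (m + 1 : ℝ) * hermiteReal m := by
  induction m with
  | zero => simp [hermiteReal_succ, hermiteReal_zero]
  | succ m ih =>
    rw [hermiteReal_succ (m + 1), derivative_sub, ih, derivative_mul, derivative_C_mul,
      derivative_X, ih, hermiteReal_succ m]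
    simp only [map_add, map_natCast, map_one, Nat.cast_succ]
    ring

theorem iterate_derivative_hermiteReal (b m : ℕ) :
    derivative^[b] (hermiteReal m) = C (m.descFactorial b : ℝ) * hermiteReal (m - b) := by
  induction b generalizing m with
  | zero => simp
  | succ b ih =>
    rw [Function.iterate_succ_apply]
    cases m with
    | zero => simp [hermiteReal_zero]
    | succ m =>
      rw [derivative_hermiteReal_succ, iterate_derivative_C_mul, ih, Nat.succ_descFactorial_succ,
        Nat.succ_sub_succ, ← mul_assoc, ← C_mul]
      push_cast
      rfl

/-- The Hermite polynomials as a graded sequence. -/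
def hermiteSequence : Polynomial.Sequence ℝ where
  elems' := hermiteReal
  degree_eq' m := by
    rw [hermiteReal, (hermite_monic m).degree_map, degree_hermite]

theorem exists_eval_eq_sum_hermiteReal {p : ℝ[X]} {m : ℕ} (hp : p.degree ≤ m) :
    ∃ c : ℕ → ℝ, ∀ x, p.eval x = ∑ k ∈ Finset.range (m + 1), c k * (hermiteReal k).eval x := by
  have hcoeff : ∀ k ≤ m, IsUnit (hermiteSequence k).leadingCoeff := fun k _ => by
    rw [show (hermiteSequence k).leadingCoeff = 1 from (hermite_monic k).map (Int.castRingHom ℝ)]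
    exact isUnit_one
  have hmem : p ∈ Submodule.span ℝ (hermiteReal '' (Finset.range (m + 1) : Set ℕ)) := by
    rw [Finset.coe_range, Set.Iio_add_one_eq_Iic]
    exact (hermiteSequence.span_degreeLE hcoeff).symm ▸ mem_degreeLE.2 hp
  obtain ⟨c, rfl⟩ := exists_eq_sum_smul_of_mem_span_image hmem
  exact ⟨c, fun x => by simp [eval_finsetSum]⟩

theorem allMoments_eval_gaussianReal (p : ℝ[X]) :
    AllMoments (fun x => p.eval x) (gaussianReal 0 1) :=
  AllMoments.polynomial (fun q hq => memLp_id_gaussianReal' q hq) p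

theorem hasDerivAt_gaussianPDFReal (x : ℝ) :
    HasDerivAt (gaussianPDFReal 0 1) (-x * gaussianPDFReal 0 1 x) x := by
  have hexponent : HasDerivAt (fun x : ℝ => -(x - 0) ^ 2 / (2 * ((1 : NNReal) : ℝ))) (-x) x := by
    refine ((((hasDerivAt_id x).sub_const 0).pow 2).neg.div_const _).congr_deriv ?_
    simp
    ring
  rw [gaussianPDFReal_def]
  exact (hexponent.exp.const_mul _).congr_deriv (by ring)

theorem integrable_gaussianPDFReal_mul_eval (p : ℝ[X]) :
    Integrable (fun x => gaussianPDFReal 0 1 x * p.eval x) := by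
  have hint := (allMoments_eval_gaussianReal p).integrable
  rw [gaussianReal_of_var_ne_zero 0 one_ne_zero, integrable_withDensity_iff_integrable_smul'
    (measurable_gaussianPDF 0 1) (ae_of_all _ fun x => gaussianPDF_lt_top)] at hint
  simp only [toReal_gaussianPDF, smul_eq_mul] at hint
  exact hint

theorem integral_eval_X_mul_gaussianReal (p : ℝ[X]) :
    ∫ x, (X * p).eval x ∂(gaussianReal 0 1) = ∫ x, (derivative p).eval x ∂(gaussianReal 0 1) := by
  have hderiv : ∀ x : ℝ, HasDerivAt (fun x => gaussianPDFReal 0 1 x * p.eval x)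
      (gaussianPDFReal 0 1 x * (derivative p - X * p).eval x) x := fun x =>
    ((hasDerivAt_gaussianPDFReal x).mul (p.hasDerivAt x)).congr_deriv <| by
      simp only [eval_sub, eval_mul, eval_X]
      ring
  have hzero : ∫ x, (derivative p - X * p).eval x ∂(gaussianReal 0 1) = 0 := by
    rw [integral_gaussianReal_eq_integral_smul one_ne_zero]
    exact integral_eq_zero_of_hasDerivAt_of_integrable hderiv
      (integrable_gaussianPDFReal_mul_eval _) (integrable_gaussianPDFReal_mul_eval _)
  simp only [eval_sub] at hzero
  rw [integral_sub (allMoments_eval_gaussianReal _).integrable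
    (allMoments_eval_gaussianReal _).integrable] at hzero
  exact (sub_eq_zero.1 hzero).symm

theorem integral_eval_hermiteReal_mul (b : ℕ) (p : ℝ[X]) :
    ∫ z, (hermiteReal b * p).eval z ∂(gaussianReal 0 1) =
      ∫ z, (derivative^[b] p).eval z ∂(gaussianReal 0 1) := by
  induction b generalizing p with
  | zero => simp [hermiteReal_zero]
  | succ b ih =>
    have hsplit : hermiteReal (b + 1) * p =
        X * (hermiteReal b * p) - derivative (hermiteReal b) * p := by
      rw [hermiteReal_succ]
      ring
    have hstein := integral_eval_X_mul_gaussianReal (hermiteReal b * p)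
    simp only [derivative_mul, eval_add] at hstein
    rw [integral_add (allMoments_eval_gaussianReal _).integrable
      (allMoments_eval_gaussianReal _).integrable] at hstein
    simp only [hsplit, eval_sub]
    rw [integral_sub (allMoments_eval_gaussianReal _).integrable
      (allMoments_eval_gaussianReal _).integrable, hstein, add_sub_cancel_left, ih,
      Function.iterate_succ_apply]

theorem integral_eval_hermiteReal_add (m : ℕ) (t : ℝ) :
    ∫ z, (hermiteReal m).eval (t + z) ∂(gaussianReal 0 1) = t ^ m := by
  induction m with
  | zero => simp [hermiteReal_zero]
  | succ m ih =>
    let p : ℝ[X] := (hermiteReal m).comp (C t + X)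
    have hsplit : ∀ z, (hermiteReal (m + 1)).eval (t + z) =
        (C t * p + X * p).eval z - (derivative p).eval z := fun z => by
      simp only [p, hermiteReal_succ, derivative_comp, eval_sub, eval_mul, eval_comp, eval_add,
        eval_X, eval_C, derivative_add, derivative_C, derivative_X, zero_add, one_mul]
      ring
    have hp : ∫ z, (C t * p).eval z ∂(gaussianReal 0 1) = t * t ^ m := by
      simp only [p, eval_mul, eval_C, eval_comp, eval_add, eval_X, integral_const_mul, ih]
    simp only [hsplit]
    rw [integral_sub (allMoments_eval_gaussianReal _).integrable
      (allMoments_eval_gaussianReal _).integrable]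
    simp only [eval_add]
    rw [integral_add (allMoments_eval_gaussianReal _).integrable
      (allMoments_eval_gaussianReal _).integrable, integral_eval_X_mul_gaussianReal,
      add_sub_cancel_right, hp, pow_succ']

theorem integral_hermiteReal_mul_hermiteReal_add (b m : ℕ) (t : ℝ) :
    ∫ z, (hermiteReal b).eval z * (hermiteReal m).eval (t + z) ∂(gaussianReal 0 1) =
      m.descFactorial b * t ^ (m - b) := by
  have hcomm : Function.Semiconj (fun p : ℝ[X] => p.comp (C t + X)) derivative derivative :=
    fun p => by simp [derivative_comp]
  have h := integral_eval_hermiteReal_mul b ((hermiteReal m).comp (C t + X))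
  rw [← hcomm.iterate_right b, iterate_derivative_hermiteReal] at h
  simpa only [eval_mul, eval_comp, eval_add, eval_C, eval_X, integral_const_mul,
    integral_eval_hermiteReal_add] using h

end Hermite

section MultiIndex

variable {ι : Type*} [Fintype ι]

/-- The factorial `α! = ∏ j, (α j)!` of a multi-index. -/
def piFactorial (α : ι → ℕ) : ℕ := ∏ j, (α j).factorial

theorem piFactorial_pos (α : ι → ℕ) : 0 < piFactorial α :=
  Finset.prod_pos fun j _ => (α j).factorial_pos

theorem prod_descFactorial (α γ : ι → ℕ) :
    ∏ j, (α j).descFactorial (γ j) = piFactorial γ * piChoose α γ := by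
  simp only [piFactorial, piChoose, ← Finset.prod_mul_distrib,
    Nat.descFactorial_eq_factorial_mul_choose]

theorem piChoose_mul_piFactorial_mul_piFactorial {α γ : ι → ℕ} (h : γ ≤ α) :
    piChoose α γ * piFactorial γ * piFactorial (α - γ) = piFactorial α := by
  simp only [piChoose, piFactorial, ← Finset.prod_mul_distrib, Pi.sub_apply]
  exact Finset.prod_congr rfl fun j _ => Nat.choose_mul_factorial_mul_factorial (h j)

theorem piChoose_symm {α γ : ι → ℕ} (h : γ ≤ α) : piChoose α (α - γ) = piChoose α γ :=
  Finset.prod_congr rfl fun j _ => Nat.choose_symm (h j)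

theorem piChoose_eq_zero {α γ : ι → ℕ} (h : ¬ γ ≤ α) : piChoose α γ = 0 := by
  obtain ⟨j, hj⟩ := not_forall.1 h
  exact Finset.prod_eq_zero (Finset.mem_univ j) (Nat.choose_eq_zero_of_lt (not_le.1 hj))

theorem sum_add_sum_tsub {α γ : ι → ℕ} (h : γ ≤ α) :
    ∑ j, γ j + ∑ j, (α - γ) j = ∑ j, α j := by
  rw [← Finset.sum_add_distrib]
  exact Finset.sum_congr rfl fun j _ => Nat.add_sub_cancel' (h j)

theorem prod_pow_add_single [DecidableEq ι] {R : Type*} [CommMonoid R] (x : ι → R) (α : ι → ℕ)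
    (i : ι) : ∏ j, x j ^ (α + Pi.single i 1 : ι → ℕ) j = (∏ j, x j ^ α j) * x i := by
  simp only [Pi.add_apply, pow_add, Finset.prod_mul_distrib, Pi.single_apply, pow_ite, pow_one,
    pow_zero, Finset.prod_ite_eq', Finset.mem_univ, if_true]

variable [DecidableEq ι]

/-- The multi-indices of total degree at most `D`. -/
def degreeLE (ι : Type*) [Fintype ι] [DecidableEq ι] (D : ℕ) : Finset (ι → ℕ) :=
  (Finset.range (D + 1)).biUnion (Finset.piAntidiag Finset.univ)

theorem mem_degreeLE {D : ℕ} {β : ι → ℕ} : β ∈ degreeLE ι D ↔ ∑ j, β j ≤ D := by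
  simp [degreeLE]

theorem sum_degreeLE {M : Type*} [AddCommMonoid M] (D : ℕ) (f : (ι → ℕ) → M) :
    ∑ β ∈ degreeLE ι D, f β =
      ∑ k ∈ Finset.range (D + 1), ∑ β ∈ Finset.piAntidiag Finset.univ k, f β :=
  Finset.sum_biUnion fun _ _ _ _ hne => Finset.disjoint_left.2 fun _ hk hl =>
    hne ((Finset.mem_piAntidiag.1 hk).1.symm.trans (Finset.mem_piAntidiag.1 hl).1)

end MultiIndex

section HermiteProd

variable {ι : Type*} [Fintype ι]

/-- The multivariate Hermite polynomial of index `β`, as a function. -/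
def hermiteProd (β : ι → ℕ) (z : ι → ℝ) : ℝ :=
  ∏ j, (hermiteReal (β j)).eval (z j)

/-- The standard Gaussian measure on `ι → ℝ`. -/
abbrev gaussianPi (ι : Type*) [Fintype ι] : Measure (ι → ℝ) :=
  Measure.pi fun _ => gaussianReal 0 1

theorem allMoments_gaussianPi (j : ι) : AllMoments (fun z : ι → ℝ => z j) (gaussianPi ι) :=
  AllMoments.comp_measurePreserving (f := fun x => x) (fun q hq => memLp_id_gaussianReal' q hq)
    (measurePreserving_eval (fun _ => gaussianReal 0 1) j)

theorem AllMoments.hermiteProd {Ω : Type*} [MeasurableSpace Ω] {μ : Measure Ω} [IsFiniteMeasure μ]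
    {F : ι → Ω → ℝ} (hF : ∀ j, AllMoments (F j) μ) (β : ι → ℕ) :
    AllMoments (fun ω => hermiteProd β fun j => F j ω) μ :=
  AllMoments.prod _ fun j _ => (hF j).polynomial _

theorem integral_hermiteProd_mul_hermiteProd_add (β m : ι → ℕ) (t : ι → ℝ) :
    ∫ z, hermiteProd β z * hermiteProd m (fun j => t j + z j) ∂(gaussianPi ι) =
      piFactorial β * piChoose m β * ∏ j, t j ^ (m - β) j := by
  simp only [hermiteProd, ← Finset.prod_mul_distrib]
  rw [integral_fintype_prod_eq_prod
    (fun j (z : ℝ) => (hermiteReal (β j)).eval z * (hermiteReal (m j)).eval (t j + z))]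
  simp only [integral_hermiteReal_mul_hermiteReal_add, Finset.prod_mul_distrib, Pi.sub_apply]
  rw [← Nat.cast_mul, ← prod_descFactorial, Nat.cast_prod]

theorem integral_hermiteProd_mul_hermiteProd (β m : ι → ℕ) :
    ∫ z, hermiteProd β z * hermiteProd m z ∂(gaussianPi ι) =
      if β = m then (piFactorial β : ℝ) else 0 := by
  have h := integral_hermiteProd_mul_hermiteProd_add β m 0
  simp only [Pi.zero_apply, zero_add] at h
  rw [h]
  split_ifs with hβm
  · simp [hβm, piChoose]
  · by_cases hle : β ≤ m
    · obtain ⟨j, hj⟩ := not_forall.1 fun hge : m ≤ β => hβm (le_antisymm hle hge)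
      rw [Finset.prod_eq_zero (Finset.mem_univ j), mul_zero]
      exact zero_pow (Nat.sub_ne_zero_of_lt (not_le.1 hj))
    · simp [piChoose_eq_zero hle]

theorem integral_sum_hermiteProd_sq (s : Finset (ι → ℕ)) (c : (ι → ℕ) → ℝ) :
    ∫ z, (∑ β ∈ s, c β * hermiteProd β z) ^ 2 ∂(gaussianPi ι) =
      ∑ β ∈ s, c β ^ 2 * piFactorial β := by
  have hint : ∀ β m : ι → ℕ, Integrable
      (fun z => c β * c m * (hermiteProd β z * hermiteProd m z)) (gaussianPi ι) := fun β m =>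
    (((AllMoments.hermiteProd allMoments_gaussianPi β).mul
      (AllMoments.hermiteProd allMoments_gaussianPi m)).const_mul _).integrable
  simp only [sq, Finset.sum_mul_sum, mul_mul_mul_comm]
  rw [integral_finsetSum _ fun β _ => integrable_finsetSum _ fun m _ => hint β m]
  refine Finset.sum_congr rfl fun β hβ => ?_
  rw [integral_finsetSum _ fun m _ => hint β m]
  simp only [integral_const_mul, integral_hermiteProd_mul_hermiteProd, mul_ite, mul_zero]
  rw [Finset.sum_ite_eq, if_pos hβ]

theorem prod_pow_mem_span_hermiteProd [DecidableEq ι] {D : ℕ} {d : ι → ℕ} (hd : ∑ j, d j ≤ D) :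
    (fun y : ι → ℝ => ∏ j, y j ^ d j) ∈
      Submodule.span ℝ (hermiteProd '' (degreeLE ι D : Set (ι → ℕ))) := by
  have hpow : ∀ j, ∃ c : ℕ → ℝ, ∀ y : ℝ, y ^ d j =
      ∑ k ∈ Finset.range (d j + 1), c k * (hermiteReal k).eval y := fun j => by
    simpa using exists_eval_eq_sum_hermiteReal (p := Polynomial.X ^ d j) (by simp)
  choose c hc using hpow
  have hexpand : (fun y : ι → ℝ => ∏ j, y j ^ d j) =
      ∑ m ∈ Fintype.piFinset fun j => Finset.range (d j + 1),
        (∏ j, c j (m j)) • (hermiteProd m : (ι → ℝ) → ℝ) := by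
    ext y
    simp only [hc, Finset.prod_univ_sum, Finset.sum_apply, Pi.smul_apply, smul_eq_mul, hermiteProd,
      Finset.prod_mul_distrib]
  rw [hexpand]
  refine Submodule.sum_mem _ fun m hm => Submodule.smul_mem _ _ (Submodule.subset_span ⟨m, ?_, rfl⟩)
  rw [Finset.mem_coe, mem_degreeLE]
  exact (Finset.sum_le_sum fun j _ =>
    Nat.lt_succ_iff.1 (Finset.mem_range.1 (Fintype.mem_piFinset.1 hm j))).trans hd

theorem exists_eval_eq_sum_hermiteProd [DecidableEq ι] {D : ℕ} {g : MvPolynomial ι ℝ}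
    (hg : g.totalDegree ≤ D) :
    ∃ c : (ι → ℕ) → ℝ, ∀ y, MvPolynomial.eval y g = ∑ m ∈ degreeLE ι D, c m * hermiteProd m y := by
  have hmem : (fun y : ι → ℝ => MvPolynomial.eval y g) ∈
      Submodule.span ℝ (hermiteProd '' (degreeLE ι D : Set (ι → ℕ))) := by
    have heval : (fun y : ι → ℝ => MvPolynomial.eval y g) =
        ∑ d ∈ g.support, g.coeff d • fun y : ι → ℝ => ∏ j, y j ^ d j := by
      ext y
      simp [MvPolynomial.eval_eq']
    rw [heval]
    refine Submodule.sum_mem _ fun d hd =>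
      Submodule.smul_mem _ _ (prod_pow_mem_span_hermiteProd ?_)
    rw [← Finsupp.sum_fintype d (fun _ e => e) fun _ => rfl]
    exact (MvPolynomial.le_totalDegree hd).trans hg
  obtain ⟨c, hc⟩ := exists_eq_sum_smul_of_mem_span_image hmem
  exact ⟨c, fun y => by simpa using congrFun hc y⟩

end HermiteProd

section DualCertificate

variable {n : ℕ}

/-- The weight of the Hermite polynomial of index `β` in `dualCertificate`. -/
def dualWeight (μ : Measure (Fin n → ℝ)) (i : Fin n) (lam : ℝ) (β : Fin n → ℕ) : ℝ :=
  cumulant μ (β + Pi.single i 1) * Real.sqrt lam ^ (∑ j, β j) / piFactorial β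

/-- A polynomial of the noise alone that has the same correlation as the `i`-th coordinate of the
signal with every polynomial of degree at most `D` in the observation
(`integral_dualCertificate_mul_eval`). -/
def dualCertificate (μ : Measure (Fin n → ℝ)) (D : ℕ) (i : Fin n) (lam : ℝ)
    (z : Fin n → ℝ) : ℝ :=
  ∑ β ∈ degreeLE (Fin n) D, dualWeight μ i lam β * hermiteProd β z

theorem integral_dualCertificate_sq (μ : Measure (Fin n → ℝ)) (D : ℕ) (i : Fin n)
    {lam : ℝ} (hlam : 0 ≤ lam) :
    ∫ z, dualCertificate μ D i lam z ^ 2 ∂(gaussianPi (Fin n)) =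
      ∑ β ∈ degreeLE (Fin n) D,
        cumulant μ (β + Pi.single i 1) ^ 2 * lam ^ (∑ j, β j) / piFactorial β := by
  refine (integral_sum_hermiteProd_sq _ _).trans (Finset.sum_congr rfl fun β _ => ?_)
  have hpos : (piFactorial β : ℝ) ≠ 0 := Nat.cast_ne_zero.2 (piFactorial_pos β).ne'
  rw [dualWeight, div_pow, mul_pow, pow_right_comm, Real.sq_sqrt hlam]
  field_simp

theorem allMoments_signal {μ : Measure (Fin n → ℝ)}
    (hX : ∀ j, AllMoments (fun x : Fin n → ℝ => x j) μ) (j : Fin n) :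
    AllMoments (fun w : (Fin n → ℝ) × (Fin n → ℝ) => w.1 j) (signalNoise μ) :=
  (hX j).comp_measurePreserving measurePreserving_fst

variable {μ : Measure (Fin n → ℝ)} [IsProbabilityMeasure μ]

theorem allMoments_noise (j : Fin n) :
    AllMoments (fun w : (Fin n → ℝ) × (Fin n → ℝ) => w.2 j) (signalNoise μ) :=
  (allMoments_gaussianPi j).comp_measurePreserving measurePreserving_snd

instance : IsProbabilityMeasure (signalNoise μ) := by
  unfold signalNoise
  infer_instance

theorem allMoments_observation (hX : ∀ j, AllMoments (fun x : Fin n → ℝ => x j) μ) (lam : ℝ)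
    (j : Fin n) : AllMoments (fun w => observation lam w j) (signalNoise μ) :=
  ((allMoments_signal hX j).const_mul _).add (allMoments_noise j)

theorem allMoments_dualCertificate (D : ℕ) (i : Fin n) (lam : ℝ) :
    AllMoments (fun w : (Fin n → ℝ) × (Fin n → ℝ) => dualCertificate μ D i lam w.2)
      (signalNoise μ) :=
  AllMoments.sum _ fun β _ => (AllMoments.hermiteProd allMoments_noise β).const_mul _

theorem moment_add_single' (α : Fin n → ℕ) (i : Fin n) :
    moment μ (α + Pi.single i 1) = ∑ β ∈ Finset.Iic α,
      piChoose α β * (cumulant μ (β + Pi.single i 1) * moment μ (α - β)) := by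
  have hmem : ∀ β ∈ Finset.Iic α, α - β ∈ Finset.Iic α := fun β _ => by simp
  have hinv : ∀ β ∈ Finset.Iic α, α - (α - β) = β := fun β hβ =>
    tsub_tsub_cancel_of_le (Finset.mem_Iic.1 hβ)
  rw [moment_add_single]
  refine Finset.sum_bij' (fun β _ => α - β) (fun β _ => α - β) hmem hmem hinv hinv fun β hβ => ?_
  rw [hinv β hβ, piChoose_symm (Finset.mem_Iic.1 hβ)]

theorem integral_hermiteProd_mul_hermiteProd_observation
    (hX : ∀ j, AllMoments (fun x : Fin n → ℝ => x j) μ) (lam : ℝ) (β m : Fin n → ℕ) :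
    ∫ w, hermiteProd β w.2 * hermiteProd m (observation lam w) ∂(signalNoise μ) =
      piFactorial β * piChoose m β *
        (Real.sqrt lam ^ (∑ j, (m - β) j) * moment μ (m - β)) := by
  have hint := ((AllMoments.hermiteProd (allMoments_noise (μ := μ)) β).mul
    (AllMoments.hermiteProd (allMoments_observation hX lam) m)).integrable
  rw [signalNoise] at hint ⊢
  rw [integral_prod _ hint]
  simp only [observation]
  simp only [integral_hermiteProd_mul_hermiteProd_add β m (fun _ => Real.sqrt lam * _), mul_pow,
    Finset.prod_mul_distrib, Finset.prod_pow_eq_pow_sum, integral_const_mul, moment]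

theorem integral_signal_mul_hermiteProd_observation
    (hX : ∀ j, AllMoments (fun x : Fin n → ℝ => x j) μ) (lam : ℝ) (i : Fin n) (m : Fin n → ℕ) :
    ∫ w, w.1 i * hermiteProd m (observation lam w) ∂(signalNoise μ) =
      Real.sqrt lam ^ (∑ j, m j) * moment μ (m + Pi.single i 1) := by
  have hint := ((allMoments_signal hX i).mul
    (AllMoments.hermiteProd (allMoments_observation hX lam) m)).integrable
  have hnoise : ∀ x : Fin n → ℝ, ∫ z, hermiteProd m (fun j => Real.sqrt lam * x j + z j)
      ∂(gaussianPi (Fin n)) = Real.sqrt lam ^ (∑ j, m j) * ∏ j, x j ^ m j := fun x => by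
    simpa [hermiteProd, hermiteReal_zero, piFactorial, piChoose, mul_pow, Finset.prod_mul_distrib,
      Finset.prod_pow_eq_pow_sum] using
      integral_hermiteProd_mul_hermiteProd_add 0 m fun j => Real.sqrt lam * x j
  rw [signalNoise] at hint ⊢
  rw [integral_prod _ hint]
  simp only [observation, integral_const_mul, hnoise, moment, prod_pow_add_single]
  rw [← integral_const_mul]
  exact integral_congr_ae (ae_of_all _ fun x => by ring)

theorem integral_dualCertificate_mul_hermiteProd
    (hX : ∀ j, AllMoments (fun x : Fin n → ℝ => x j) μ) (lam : ℝ) (i : Fin n) {D : ℕ}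
    {m : Fin n → ℕ} (hm : m ∈ degreeLE (Fin n) D) :
    ∫ w, dualCertificate μ D i lam w.2 * hermiteProd m (observation lam w) ∂(signalNoise μ) =
      ∫ w, w.1 i * hermiteProd m (observation lam w) ∂(signalNoise μ) := by
  have hint : ∀ β : Fin n → ℕ, Integrable (fun w : (Fin n → ℝ) × (Fin n → ℝ) =>
      dualWeight μ i lam β * (hermiteProd β w.2 * hermiteProd m (observation lam w)))
      (signalNoise μ) := fun β =>
    (((AllMoments.hermiteProd (allMoments_noise (μ := μ)) β).mul
      (AllMoments.hermiteProd (allMoments_observation hX lam) m)).const_mul _).integrable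
  have hsub : Finset.Iic m ⊆ degreeLE (Fin n) D := fun β hβ =>
    mem_degreeLE.2 ((Finset.sum_le_sum fun j _ => Finset.mem_Iic.1 hβ j).trans (mem_degreeLE.1 hm))
  simp only [dualCertificate, Finset.sum_mul, mul_assoc]
  rw [integral_finsetSum _ fun β _ => hint β]
  simp only [integral_const_mul, integral_hermiteProd_mul_hermiteProd_observation hX,
    integral_signal_mul_hermiteProd_observation hX]
  rw [moment_add_single', Finset.mul_sum, ← Finset.sum_subset hsub]
  · refine Finset.sum_congr rfl fun β hβ => ?_
    have hpos : (piFactorial β : ℝ) ≠ 0 := Nat.cast_ne_zero.2 (piFactorial_pos β).ne'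
    rw [dualWeight, ← sum_add_sum_tsub (Finset.mem_Iic.1 hβ), pow_add]
    field_simp
  · intro β _ hβ
    simp [piChoose_eq_zero fun h => hβ (Finset.mem_Iic.2 h)]

theorem integral_dualCertificate_mul_eval
    (hX : ∀ j, AllMoments (fun x : Fin n → ℝ => x j) μ) (lam : ℝ) (i : Fin n) {D : ℕ}
    {g : MvPolynomial (Fin n) ℝ} (hg : g.totalDegree ≤ D) :
    ∫ w, dualCertificate μ D i lam w.2 * MvPolynomial.eval (observation lam w) g
        ∂(signalNoise μ) =
      ∫ w, w.1 i * MvPolynomial.eval (observation lam w) g ∂(signalNoise μ) := by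
  obtain ⟨c, hc⟩ := exists_eval_eq_sum_hermiteProd hg
  have hlin : ∀ U : (Fin n → ℝ) × (Fin n → ℝ) → ℝ, AllMoments U (signalNoise μ) →
      ∫ w, U w * MvPolynomial.eval (observation lam w) g ∂(signalNoise μ) =
        ∑ m ∈ degreeLE (Fin n) D,
          c m * ∫ w, U w * hermiteProd m (observation lam w) ∂(signalNoise μ) := by
    intro U hU
    simp only [hc, Finset.mul_sum, mul_left_comm (U _)]
    rw [integral_finsetSum _ fun m _ =>
      ((hU.mul (AllMoments.hermiteProd (allMoments_observation hX lam) m)).const_mul _).integrable]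
    simp only [integral_const_mul]
  rw [hlin _ (allMoments_dualCertificate D i lam), hlin _ (allMoments_signal hX i)]
  refine Finset.sum_congr rfl fun m hm => ?_
  rw [integral_dualCertificate_mul_hermiteProd hX lam i hm]

theorem corr_sq_le_sum_cumulant_sq (hX : ∀ j, AllMoments (fun x : Fin n → ℝ => x j) μ) (D : ℕ)
    {lam : ℝ} (hlam : 0 ≤ lam) :
    corr μ D lam ^ 2 ≤ ∑ i, ∑ β ∈ degreeLE (Fin n) D,
      cumulant μ (β + Pi.single i 1) ^ 2 * lam ^ (∑ j, β j) / piFactorial β := by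
  rw [corr, Real.sq_sqrt (Finset.sum_nonneg fun i _ => Real.sSup_nonneg <| by
    rintro r ⟨g, _, _, rfl⟩
    exact sq_nonneg _)]
  refine Finset.sum_le_sum fun i _ => ?_
  rw [← integral_dualCertificate_sq μ D i hlam]
  refine Real.sSup_le ?_ (integral_nonneg fun _ => sq_nonneg _)
  rintro r ⟨g, hg, hnorm, rfl⟩
  have hnoise : ∫ w, dualCertificate μ D i lam w.2 ^ 2 ∂(signalNoise μ) =
      ∫ z, dualCertificate μ D i lam z ^ 2 ∂(gaussianPi (Fin n)) := by
    rw [signalNoise, integral_fun_snd (fun z => dualCertificate μ D i lam z ^ 2)]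
    simp
  calc (∫ w, MvPolynomial.eval (observation lam w) g * w.1 i ∂(signalNoise μ)) ^ 2
      = (∫ w, dualCertificate μ D i lam w.2 * MvPolynomial.eval (observation lam w) g
          ∂(signalNoise μ)) ^ 2 := by
        simp only [integral_dualCertificate_mul_eval hX lam i hg, mul_comm]
    _ ≤ (∫ w, dualCertificate μ D i lam w.2 ^ 2 ∂(signalNoise μ)) *
          ∫ w, MvPolynomial.eval (observation lam w) g ^ 2 ∂(signalNoise μ) :=
        sq_integral_mul_le (allMoments_dualCertificate D i lam).memLp_two
          (AllMoments.mvPolynomial (allMoments_observation hX lam) g).memLp_two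
    _ = ∫ z, dualCertificate μ D i lam z ^ 2 ∂(gaussianPi (Fin n)) := by
        rw [hnorm, mul_one, hnoise]

end DualCertificate

section MultiIndexSums

open Finset.HasAntidiagonal (antidiagonal mem_antidiagonal)

theorem exists_eq_add_single {ι : Type*} [DecidableEq ι] {α : ι → ℕ} (h : α ≠ 0) :
    ∃ (γ : ι → ℕ) (i : ι), α = γ + Pi.single i 1 := by
  obtain ⟨i, hi⟩ := Function.ne_iff.1 h
  refine ⟨α - Pi.single i 1, i, (tsub_add_cancel_of_le fun j => ?_).symm⟩
  rcases eq_or_ne j i with rfl | hj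
  · simpa [Nat.one_le_iff_ne_zero] using hi
  · simp [hj]

variable {ι : Type*} [Fintype ι]

theorem sum_tsub_le (α γ : ι → ℕ) : ∑ j, (α - γ) j ≤ ∑ j, α j :=
  Finset.sum_le_sum fun _ _ => tsub_le_self

variable [DecidableEq ι]

theorem sum_add_single (α : ι → ℕ) (i : ι) :
    ∑ j, (α + Pi.single i 1 : ι → ℕ) j = ∑ j, α j + 1 := by
  simp [Finset.sum_add_distrib]

theorem sum_lt_of_mem_erase_Iic {α β : ι → ℕ} (h : β ∈ (Finset.Iic α).erase α) :
    ∑ j, β j < ∑ j, α j := by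
  obtain ⟨hne, hmem⟩ := Finset.mem_erase.1 h
  have hle : β ≤ α := Finset.mem_Iic.1 hmem
  obtain ⟨j, hj⟩ := not_forall.1 fun hge : α ≤ β => hne (le_antisymm hle hge)
  exact Finset.sum_lt_sum (fun k _ => hle k) ⟨j, Finset.mem_univ j, not_le.1 hj⟩

theorem sum_piChoose (α : ι → ℕ) : ∑ γ ∈ Finset.Iic α, piChoose α γ = 2 ^ ∑ j, α j := by
  have hIic : Finset.Iic α = Fintype.piFinset fun j => Finset.range (α j + 1) := by
    ext γ
    simp [Pi.le_def]
  simp only [hIic, piChoose]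
  rw [← Finset.prod_univ_sum (fun j => Finset.range (α j + 1)) fun j k => (α j).choose k]
  simp only [Nat.sum_range_choose, Finset.prod_pow_eq_pow_sum]

theorem sum_piAntidiag_sum_Iic {R : Type*} [Semiring R] (k : ℕ) (f g : (ι → ℕ) → R) :
    ∑ α ∈ Finset.piAntidiag Finset.univ k, ∑ β ∈ Finset.Iic α, f β * g (α - β) =
      ∑ p ∈ antidiagonal k, (∑ β ∈ Finset.piAntidiag Finset.univ p.1, f β) *
        ∑ γ ∈ Finset.piAntidiag Finset.univ p.2, g γ := by
  simp only [Finset.sum_mul_sum, Finset.sum_sigma']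
  refine Finset.sum_bij'
    (fun x _ => ⟨(∑ j, x.2 j, ∑ j, (x.1 - x.2) j), x.2, x.1 - x.2⟩)
    (fun y _ => ⟨y.2.1 + y.2.2, y.2.1⟩) ?_ ?_ ?_ ?_ ?_
  · rintro ⟨α, β⟩ h
    obtain ⟨rfl, hβ⟩ : ∑ j, α j = k ∧ β ≤ α := by simpa using h
    simpa using sum_add_sum_tsub hβ
  · rintro ⟨⟨a, b⟩, β, γ⟩ h
    obtain ⟨rfl, rfl, rfl⟩ : a + b = k ∧ ∑ j, β j = a ∧ ∑ j, γ j = b := by simpa using h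
    simp [Finset.sum_add_distrib]
  · rintro ⟨α, β⟩ h
    obtain ⟨-, hβ⟩ : ∑ j, α j = k ∧ β ≤ α := by simpa using h
    simp only [add_tsub_cancel_of_le hβ]
  · rintro ⟨⟨a, b⟩, β, γ⟩ h
    obtain ⟨-, rfl, rfl⟩ : a + b = k ∧ ∑ j, β j = a ∧ ∑ j, γ j = b := by simpa using h
    simp only [add_tsub_cancel_left]
  · exact fun _ _ => rfl

theorem sum_antidiagonal_inv_factorial (k : ℕ) :
    ∑ p ∈ antidiagonal k, (p.1.factorial : ℝ)⁻¹ * (p.2.factorial : ℝ)⁻¹ =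
      2 ^ k / k.factorial := by
  have hterm : ∀ p ∈ antidiagonal k,
      (p.1.factorial : ℝ)⁻¹ * (p.2.factorial : ℝ)⁻¹ = (k.choose p.1 : ℝ) / k.factorial := by
    rintro ⟨a, b⟩ hp
    obtain rfl : a + b = k := mem_antidiagonal.1 hp
    have hpos : ((a + b).factorial : ℝ) ≠ 0 := Nat.cast_ne_zero.2 (Nat.factorial_ne_zero _)
    rw [Nat.cast_add_choose]
    field_simp
  rw [Finset.sum_congr rfl hterm, ← Finset.sum_div,
    Finset.Nat.sum_antidiagonal_eq_sum_range_succ_mk]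
  exact_mod_cast congrArg (fun N : ℕ => (N : ℝ) / k.factorial) (Nat.sum_range_choose k)

end MultiIndexSums

section OverlapMoments

variable {n : ℕ} {μ : Measure (Fin n → ℝ)} [IsProbabilityMeasure μ]

instance : IsProbabilityMeasure (replicas μ) := by
  unfold replicas
  infer_instance

theorem AllMoments.fst_mul_snd {f g : (Fin n → ℝ) → ℝ} (hf : AllMoments f μ)
    (hg : AllMoments g μ) : AllMoments (fun z => f z.1 * g z.2) (replicas μ) :=
  (hf.comp_measurePreserving measurePreserving_fst).mul
    (hg.comp_measurePreserving measurePreserving_snd)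

theorem allMoments_overlap (hX : ∀ j, AllMoments (fun x : Fin n → ℝ => x j) μ) :
    AllMoments overlap (replicas μ) :=
  AllMoments.sum _ fun j _ => (hX j).fst_mul_snd (hX j)

theorem overlap_pow_eq_sum (z : (Fin n → ℝ) × (Fin n → ℝ)) (k : ℕ) :
    overlap z ^ k = ∑ α ∈ Finset.piAntidiag Finset.univ k,
      (k.factorial : ℝ) / piFactorial α * ((∏ j, z.1 j ^ α j) * ∏ j, z.2 j ^ α j) := by
  rw [overlap, Finset.sum_pow_eq_sum_piAntidiag]
  refine Finset.sum_congr rfl fun α hα => ?_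
  have hpos : (piFactorial α : ℝ) ≠ 0 := Nat.cast_ne_zero.2 (piFactorial_pos α).ne'
  have hmultinomial : (Nat.multinomial Finset.univ α : ℝ) = k.factorial / piFactorial α := by
    rw [eq_div_iff hpos, mul_comm, ← (Finset.mem_piAntidiag.1 hα).1]
    exact_mod_cast Nat.multinomial_spec Finset.univ α
  simp only [hmultinomial, mul_pow, Finset.prod_mul_distrib]

theorem integral_mul_mul_overlap_pow (hX : ∀ j, AllMoments (fun x : Fin n → ℝ => x j) μ)
    {f : (Fin n → ℝ) → ℝ} (hf : AllMoments f μ) (k : ℕ) :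
    ∫ z, f z.1 * f z.2 * overlap z ^ k ∂(replicas μ) = (k.factorial : ℝ) *
      ∑ α ∈ Finset.piAntidiag Finset.univ k,
        (∫ x, (∏ j, x j ^ α j) * f x ∂μ) ^ 2 / piFactorial α := by
  have hmonomial : ∀ α : Fin n → ℕ, AllMoments (fun x => (∏ j, x j ^ α j) * f x) μ := fun α =>
    (AllMoments.prod _ fun j _ => (hX j).pow _).mul hf
  have hexpand : ∀ z : (Fin n → ℝ) × (Fin n → ℝ), f z.1 * f z.2 * overlap z ^ k =
      ∑ α ∈ Finset.piAntidiag Finset.univ k, (k.factorial : ℝ) / piFactorial α *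
        (((∏ j, z.1 j ^ α j) * f z.1) * ((∏ j, z.2 j ^ α j) * f z.2)) := fun z => by
    rw [overlap_pow_eq_sum, Finset.mul_sum]
    exact Finset.sum_congr rfl fun α _ => by ring
  simp only [hexpand]
  rw [integral_finsetSum _ fun α _ =>
    (((hmonomial α).fst_mul_snd (hmonomial α)).const_mul _).integrable, Finset.mul_sum]
  refine Finset.sum_congr rfl fun α _ => ?_
  rw [integral_const_mul, replicas, integral_prod_mul (fun x => (∏ j, x j ^ α j) * f x)
    (fun x => (∏ j, x j ^ α j) * f x)]
  ring

theorem integral_overlap_pow (hX : ∀ j, AllMoments (fun x : Fin n → ℝ => x j) μ) (k : ℕ) :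
    ∫ z, overlap z ^ k ∂(replicas μ) = (k.factorial : ℝ) *
      ∑ α ∈ Finset.piAntidiag Finset.univ k, moment μ α ^ 2 / piFactorial α := by
  simpa only [one_mul, mul_one, moment] using
    integral_mul_mul_overlap_pow hX (AllMoments.const (μ := μ) 1) k

theorem integral_overlap_pow_succ (hX : ∀ j, AllMoments (fun x : Fin n → ℝ => x j) μ) (k : ℕ) :
    ∫ z, overlap z ^ (k + 1) ∂(replicas μ) = (k.factorial : ℝ) *
      ∑ i, ∑ α ∈ Finset.piAntidiag Finset.univ k,
        moment μ (α + Pi.single i 1) ^ 2 / piFactorial α := by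
  have hexpand : ∀ z : (Fin n → ℝ) × (Fin n → ℝ),
      overlap z ^ (k + 1) = ∑ i, z.1 i * z.2 i * overlap z ^ k := fun z => by
    rw [pow_succ', overlap, Finset.sum_mul]
  simp only [hexpand]
  rw [integral_finsetSum _ fun i _ =>
    (((hX i).fst_mul_snd (hX i)).mul ((allMoments_overlap hX).pow k)).integrable, Finset.mul_sum]
  refine Finset.sum_congr rfl fun i _ => ?_
  simp only [integral_mul_mul_overlap_pow hX (hX i), moment, prod_pow_add_single]

theorem integral_overlap_pow_nonneg (hX : ∀ j, AllMoments (fun x : Fin n → ℝ => x j) μ) (k : ℕ) :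
    0 ≤ ∫ z, overlap z ^ k ∂(replicas μ) := by
  rw [integral_overlap_pow hX]
  positivity

end OverlapMoments

section CumulantBounds

open Finset.HasAntidiagonal (antidiagonal mem_antidiagonal)

variable {n D : ℕ} {μ : Measure (Fin n → ℝ)} [IsProbabilityMeasure μ]

theorem moment_zero : moment μ 0 = 1 := by simp [moment]

theorem moment_nonneg_of_cumulant_nonneg
    (hκ : ∀ α : Fin n → ℕ, ∑ i, α i ≤ D → 0 ≤ cumulant μ α) (α : Fin n → ℕ)
    (hα : ∑ i, α i ≤ D) : 0 ≤ moment μ α := by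
  induction hk : ∑ i, α i using Nat.strong_induction_on generalizing α with
  | _ k ih =>
    subst hk
    rcases eq_or_ne α 0 with rfl | h0
    · exact moment_zero.ge.trans' zero_le_one
    · obtain ⟨γ, i, rfl⟩ := exists_eq_add_single h0
      rw [sum_add_single] at hα ih
      rw [moment_add_single']
      refine Finset.sum_nonneg fun β hβ => ?_
      have hsum := sum_add_sum_tsub (Finset.mem_Iic.1 hβ)
      have hcumulant : 0 ≤ cumulant μ (β + Pi.single i 1) := hκ _ (by rw [sum_add_single]; lia)
      have hmoment : 0 ≤ moment μ (γ - β) := ih _ (by lia) _ (by lia) rfl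
      positivity

theorem moment_add_single_eq_cumulant_add (α : Fin n → ℕ) (i : Fin n) :
    moment μ (α + Pi.single i 1) = cumulant μ (α + Pi.single i 1) +
      ∑ β ∈ (Finset.Iic α).erase α,
        piChoose α β * (cumulant μ (β + Pi.single i 1) * moment μ (α - β)) := by
  rw [moment_add_single', ← Finset.add_sum_erase _ _ (Finset.mem_Iic.2 le_rfl)]
  simp [moment_zero, piChoose]

theorem cumulant_le_moment (hκ : ∀ α : Fin n → ℕ, ∑ i, α i ≤ D → 0 ≤ cumulant μ α)
    (α : Fin n → ℕ) (i : Fin n) (hα : ∑ i, α i ≤ D) :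
    cumulant μ (α + Pi.single i 1) ≤ moment μ (α + Pi.single i 1) := by
  rw [moment_add_single_eq_cumulant_add, le_add_iff_nonneg_right]
  refine Finset.sum_nonneg fun β hβ => ?_
  have hlt := sum_lt_of_mem_erase_Iic hβ
  have hcumulant := hκ (β + Pi.single i 1) (by rw [sum_add_single]; lia)
  have hmoment := moment_nonneg_of_cumulant_nonneg hκ (α - β) ((sum_tsub_le α β).trans hα)
  positivity

theorem abs_cumulant_le (hκ : ∀ α : Fin n → ℕ, ∑ i, α i ≤ D → 0 ≤ cumulant μ α)
    (α : Fin n → ℕ) (i : Fin n) (hα : ∑ i, α i ≤ D) :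
    |cumulant μ (α + Pi.single i 1)| ≤ ∑ β ∈ Finset.Iic α,
      piChoose α β * (|moment μ (β + Pi.single i 1)| * moment μ (α - β)) := by
  rw [← Finset.add_sum_erase _ _ (Finset.mem_Iic.2 le_rfl),
    eq_sub_of_add_eq (moment_add_single_eq_cumulant_add (μ := μ) α i).symm]
  refine (abs_sub _ _).trans (add_le_add ?_ ?_)
  · simp [moment_zero, piChoose]
  · refine (Finset.abs_sum_le_sum_abs _ _).trans (Finset.sum_le_sum fun β hβ => ?_)
    have hlt := sum_lt_of_mem_erase_Iic hβ
    have hcumulant := hκ (β + Pi.single i 1) (by rw [sum_add_single]; lia)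
    have hmoment := moment_nonneg_of_cumulant_nonneg hκ (α - β) ((sum_tsub_le α β).trans hα)
    rw [abs_of_nonneg (by positivity)]
    gcongr
    exact (cumulant_le_moment hκ β i (by lia)).trans (le_abs_self _)

theorem cumulant_sq_le (hκ : ∀ α : Fin n → ℕ, ∑ i, α i ≤ D → 0 ≤ cumulant μ α)
    (α : Fin n → ℕ) (i : Fin n) (hα : ∑ i, α i ≤ D) :
    cumulant μ (α + Pi.single i 1) ^ 2 ≤ 2 ^ (∑ j, α j) * ∑ β ∈ Finset.Iic α,
      piChoose α β * (moment μ (β + Pi.single i 1) ^ 2 * moment μ (α - β) ^ 2) := by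
  have hcast : (2 : ℝ) ^ (∑ j, α j) = ∑ β ∈ Finset.Iic α, (piChoose α β : ℝ) :=
    mod_cast (sum_piChoose α).symm
  rw [hcast, ← sq_abs]
  refine (pow_le_pow_left₀ (abs_nonneg _) (abs_cumulant_le hκ α i hα) 2).trans ?_
  refine Finset.sum_sq_le_sum_mul_sum_of_sq_le_mul _ (fun β _ => Nat.cast_nonneg _)
    (fun β _ => by positivity) fun β _ => ?_
  rw [mul_pow, mul_pow, sq_abs, sq, mul_assoc]

/-- The squared norm `∑ i, ∑ |α| = k, κ(α + e_i)² / α!` of the cumulants of order `k + 1`, in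
which the multi-indices have the weights of the Hermite expansion. -/
def cumulantEnergy (μ : Measure (Fin n → ℝ)) (k : ℕ) : ℝ :=
  ∑ i, ∑ α ∈ Finset.piAntidiag Finset.univ k, cumulant μ (α + Pi.single i 1) ^ 2 / piFactorial α

theorem corr_sq_le_sum_cumulantEnergy (hX : ∀ j, AllMoments (fun x : Fin n → ℝ => x j) μ) (D : ℕ)
    {lam : ℝ} (hlam : 0 ≤ lam) :
    corr μ D lam ^ 2 ≤ ∑ k ∈ Finset.range (D + 1), lam ^ k * cumulantEnergy μ k := by
  refine (corr_sq_le_sum_cumulant_sq hX D hlam).trans_eq ?_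
  simp only [sum_degreeLE, cumulantEnergy, Finset.mul_sum]
  rw [Finset.sum_comm]
  refine Finset.sum_congr rfl fun k _ => Finset.sum_congr rfl fun i _ =>
    Finset.sum_congr rfl fun α hα => ?_
  rw [(Finset.mem_piAntidiag.1 hα).1]
  ring

theorem cumulantEnergy_le (hX : ∀ j, AllMoments (fun x : Fin n → ℝ => x j) μ)
    (hκ : ∀ α : Fin n → ℕ, ∑ i, α i ≤ D → 0 ≤ cumulant μ α) {k : ℕ} (hk : k ≤ D) :
    cumulantEnergy μ k ≤ 2 ^ k * ∑ p ∈ antidiagonal k,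
      ((∫ z, overlap z ^ (p.1 + 1) ∂(replicas μ)) / p.1.factorial) *
        ((∫ z, overlap z ^ p.2 ∂(replicas μ)) / p.2.factorial) := by
  have hterm : ∀ i, ∀ α ∈ Finset.piAntidiag (Finset.univ : Finset (Fin n)) k,
      cumulant μ (α + Pi.single i 1) ^ 2 / piFactorial α ≤ 2 ^ k * ∑ β ∈ Finset.Iic α,
        moment μ (β + Pi.single i 1) ^ 2 / piFactorial β *
          (moment μ (α - β) ^ 2 / piFactorial (α - β)) := by
    intro i α hα
    have hdeg : ∑ j, α j = k := (Finset.mem_piAntidiag.1 hα).1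
    have hpos : ∀ γ : Fin n → ℕ, (0 : ℝ) < piFactorial γ := fun γ =>
      Nat.cast_pos.2 (piFactorial_pos γ)
    rw [div_le_iff₀ (hpos α), mul_assoc, Finset.sum_mul, ← hdeg]
    refine (cumulant_sq_le hκ α i (hdeg.trans_le hk)).trans_eq ?_
    congr 1
    refine Finset.sum_congr rfl fun β hβ => ?_
    have hβpos := (hpos β).ne'
    have hsubpos := (hpos (α - β)).ne'
    rw [← piChoose_mul_piFactorial_mul_piFactorial (Finset.mem_Iic.1 hβ)]
    push_cast
    field_simp
  have hfac : ∀ m : ℕ, (m.factorial : ℝ) ≠ 0 := fun m => Nat.cast_ne_zero.2 m.factorial_ne_zero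
  simp only [integral_overlap_pow_succ hX, integral_overlap_pow hX,
    mul_div_cancel_left₀ _ (hfac _), Finset.sum_mul (s := Finset.univ)]
  rw [Finset.sum_comm, Finset.mul_sum, cumulantEnergy]
  refine Finset.sum_le_sum fun i _ => (Finset.sum_le_sum (hterm i)).trans_eq ?_
  rw [← Finset.mul_sum]
  exact congrArg (2 ^ k * ·) (sum_piAntidiag_sum_Iic k
    (fun β => moment μ (β + Pi.single i 1) ^ 2 / (piFactorial β : ℝ))
    fun γ => moment μ γ ^ 2 / (piFactorial γ : ℝ))

variable {q b : ℝ}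

theorem cumulantEnergy_le_of_overlap_moments
    (hX : ∀ j, AllMoments (fun x : Fin n → ℝ => x j) μ)
    (hκ : ∀ α : Fin n → ℕ, ∑ i, α i ≤ D → 0 ≤ cumulant μ α) (hq : 0 ≤ q) (hb : 0 ≤ b)
    (hmom : ∀ m ≤ D + 1, ∫ z, overlap z ^ m ∂(replicas μ) ≤ b * q ^ m) {k : ℕ} (hk : k ≤ D) :
    cumulantEnergy μ k ≤ b ^ 2 * q * ((4 * q) ^ k / k.factorial) := by
  calc cumulantEnergy μ k
      ≤ 2 ^ k * ∑ p ∈ antidiagonal k,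
          ((∫ z, overlap z ^ (p.1 + 1) ∂(replicas μ)) / p.1.factorial) *
            ((∫ z, overlap z ^ p.2 ∂(replicas μ)) / p.2.factorial) := cumulantEnergy_le hX hκ hk
    _ ≤ 2 ^ k * ∑ p ∈ antidiagonal k, (b ^ 2 * q ^ (k + 1)) *
          ((p.1.factorial : ℝ)⁻¹ * (p.2.factorial : ℝ)⁻¹) := by
        gcongr 2 ^ k * ?_
        refine Finset.sum_le_sum fun p hp => ?_
        have hpk := mem_antidiagonal.1 hp
        calc _ ≤ (b * q ^ (p.1 + 1) / p.1.factorial) * (b * q ^ p.2 / p.2.factorial) := by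
              have := integral_overlap_pow_nonneg hX p.2
              gcongr
              · exact hmom _ (by lia)
              · exact hmom _ (by lia)
          _ = _ := by
              rw [← hpk]
              ring
    _ = b ^ 2 * q * ((4 * q) ^ k / k.factorial) := by
        rw [← Finset.mul_sum, sum_antidiagonal_inv_factorial, mul_pow,
          show (4 : ℝ) = 2 * 2 by norm_num, mul_pow]
        ring

theorem corr_sq_le_of_overlap_moments (hX : ∀ j, AllMoments (fun x : Fin n → ℝ => x j) μ)
    (hκ : ∀ α : Fin n → ℕ, ∑ i, α i ≤ D → 0 ≤ cumulant μ α) (hq : 0 ≤ q) (hb : 0 ≤ b)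
    (hmom : ∀ m ≤ D + 1, ∫ z, overlap z ^ m ∂(replicas μ) ≤ b * q ^ m)
    {lam : ℝ} (hlam : 0 ≤ lam) :
    corr μ D lam ^ 2 ≤ b ^ 2 * q * Real.exp (4 * lam * q) := by
  calc corr μ D lam ^ 2
      ≤ ∑ k ∈ Finset.range (D + 1), lam ^ k * cumulantEnergy μ k :=
        corr_sq_le_sum_cumulantEnergy hX D hlam
    _ ≤ ∑ k ∈ Finset.range (D + 1), lam ^ k * (b ^ 2 * q * ((4 * q) ^ k / k.factorial)) := by
        gcongr with k hk
        exact cumulantEnergy_le_of_overlap_moments hX hκ hq hb hmom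
          (Nat.lt_succ_iff.1 (Finset.mem_range.1 hk))
    _ = b ^ 2 * q * ∑ k ∈ Finset.range (D + 1), (4 * lam * q) ^ k / k.factorial := by
        rw [Finset.mul_sum]
        refine Finset.sum_congr rfl fun k _ => ?_
        rw [show 4 * lam * q = lam * (4 * q) by ring, mul_pow]
        ring
    _ ≤ b ^ 2 * q * Real.exp (4 * lam * q) := by
        gcongr
        exact Real.sum_le_exp_of_nonneg (by positivity) (D + 1)

end CumulantBounds

theorem measurable_overlap {n : ℕ} : Measurable (overlap (n := n)) := by
  unfold overlap
  fun_prop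

section Quantile

theorem le_stieltjes_sInf (F : StieltjesFunction ℝ) {p : ℝ} (h : {y | p ≤ F y}.Nonempty) :
    p ≤ F (sInf {y | p ≤ F y}) := by
  refine ge_of_tendsto ((F.right_continuous _).mono Set.Ioi_subset_Ici_self)
    (eventually_nhdsWithin_of_forall fun y hy => ?_)
  obtain ⟨x, hx, hxy⟩ := exists_lt_of_csInf_lt h hy
  exact hx.trans (F.mono hxy.le)

variable {n : ℕ} {μ : Measure (Fin n → ℝ)} [IsProbabilityMeasure μ] {D : ℝ}

/-- The law of `|⟨X, X'⟩|`. -/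
def absOverlapLaw (μ : Measure (Fin n → ℝ)) : Measure ℝ :=
  (replicas μ).map fun z => |overlap z|

instance : IsProbabilityMeasure (absOverlapLaw μ) :=
  Measure.isProbabilityMeasure_map measurable_overlap.abs.aemeasurable

theorem replicas_real_abs_overlap_le (y : ℝ) :
    (replicas μ).real {z | |overlap z| ≤ y} = cdf (absOverlapLaw μ) y := by
  rw [cdf_eq_real, absOverlapLaw, map_measureReal_apply measurable_overlap.abs measurableSet_Iic]
  rfl

theorem quantile_eq_sInf_cdf (D : ℝ) :
    quantile μ D = sInf {y | 1 - Real.exp (-D) ≤ cdf (absOverlapLaw μ) y} := by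
  simp only [quantile, replicas_real_abs_overlap_le]

theorem nonempty_le_cdf (ν : Measure ℝ) {p : ℝ} (hp : p < 1) : {y | p ≤ cdf ν y}.Nonempty :=
  ((tendsto_cdf_atTop ν).eventually_const_le hp).exists

theorem bddBelow_le_cdf (ν : Measure ℝ) {p : ℝ} (hp : 0 < p) : BddBelow {y | p ≤ cdf ν y} := by
  obtain ⟨x, hx⟩ := ((tendsto_cdf_atBot ν).eventually_lt_const hp).exists
  exact ⟨x, fun y hy => ((monotone_cdf ν).reflect_lt (hx.trans_le hy)).le⟩

theorem quantile_mono {D' : ℝ} (hD : 0 < D) (h : D ≤ D') : quantile μ D ≤ quantile μ D' := by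
  simp only [quantile_eq_sInf_cdf]
  refine csInf_le_csInf (bddBelow_le_cdf _ (by simpa using hD))
    (nonempty_le_cdf _ (sub_lt_self _ (Real.exp_pos _))) fun y hy =>
      (sub_le_sub_left (Real.exp_le_exp.2 (neg_le_neg h)) 1).trans hy

theorem measureReal_quantile_lt_le (D : ℝ) :
    (replicas μ).real {z | quantile μ D < |overlap z|} ≤ Real.exp (-D) := by
  have hcompl : {z : (Fin n → ℝ) × (Fin n → ℝ) | quantile μ D < |overlap z|} =
      {z | |overlap z| ≤ quantile μ D}ᶜ := by
    ext z
    simp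
  rw [hcompl, probReal_compl_eq_one_sub (measurableSet_le measurable_overlap.abs measurable_const),
    sub_le_comm, replicas_real_abs_overlap_le, quantile_eq_sInf_cdf]
  exact le_stieltjes_sInf _ (nonempty_le_cdf _ (sub_lt_self _ (Real.exp_pos _)))

end Quantile

section SubWeibull

theorem eLpNorm_fst_mul_snd {Ω Ω' : Type*} [MeasurableSpace Ω] [MeasurableSpace Ω']
    {ν : Measure Ω} {ν' : Measure Ω'} [SFinite ν'] {Y : Ω → ℝ} {Y' : Ω' → ℝ}
    (hY : AEMeasurable Y ν) (hY' : AEMeasurable Y' ν') {p : ℝ≥0∞} (hp : p ≠ 0)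
    (hp' : p ≠ ∞) :
    eLpNorm (fun z : Ω × Ω' => Y z.1 * Y' z.2) p (ν.prod ν') = eLpNorm Y p ν * eLpNorm Y' p ν' := by
  simp only [eLpNorm_eq_lintegral_rpow_enorm_toReal hp hp', enorm_mul,
    ENNReal.mul_rpow_of_nonneg _ _ ENNReal.toReal_nonneg]
  rw [lintegral_prod_mul (hY.enorm.pow_const _) (hY'.enorm.pow_const _),
    ENNReal.mul_rpow_of_nonneg _ _ (by positivity)]

variable {Ω : Type*} [MeasurableSpace Ω] {ν : Measure Ω} [IsProbabilityMeasure ν]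
  {φ K : ℝ} {Y : Ω → ℝ}

theorem IsSubWeibull.allMoments (h : IsSubWeibull φ K Y ν) (hY : Measurable Y) :
    AllMoments Y ν := by
  intro p hp
  have hmemLp : MemLp Y (ENNReal.ofReal (max p.toReal 1)) ν :=
    ⟨hY.aestronglyMeasurable, (h _ (le_max_right _ _)).trans_lt ENNReal.ofReal_lt_top⟩
  refine hmemLp.mono_exponent ?_
  exact (ENNReal.ofReal_toReal hp).ge.trans (ENNReal.ofReal_le_ofReal (le_max_left _ _))

theorem IsSubWeibull.integral_abs_pow_le (hK : 0 ≤ K) (h : IsSubWeibull φ K Y ν)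
    (hY : Measurable Y) {k : ℕ} (hk : 1 ≤ k) :
    ∫ ω, |Y ω| ^ k ∂ν ≤ (K * (k : ℝ) ^ (1 / φ)) ^ k := by
  have hnorm := h k (Nat.one_le_cast.2 hk)
  have hk0 : k ≠ 0 := Nat.one_le_iff_ne_zero.1 hk
  rw [(h.allMoments hY (ENNReal.ofReal k) ENNReal.ofReal_ne_top).eLpNorm_eq_integral_rpow_norm
    (by simpa using hk0) ENNReal.ofReal_ne_top, ENNReal.ofReal_le_ofReal_iff (by positivity),
    ENNReal.toReal_ofReal k.cast_nonneg] at hnorm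
  simp only [Real.norm_eq_abs, Real.rpow_natCast] at hnorm
  have hpow := pow_le_pow_left₀ (by positivity) hnorm k
  rwa [Real.rpow_inv_natCast_pow (by positivity) hk0] at hpow

theorem isSubWeibull_overlap {n : ℕ} {μ : Measure (Fin n → ℝ)} [IsProbabilityMeasure μ]
    (hK : 0 ≤ K) (h : ∀ i : Fin n, IsSubWeibull φ K (fun x => x i) μ) :
    IsSubWeibull (φ / 2) (n * K ^ 2) overlap (replicas μ) := by
  intro p hp
  have hp0 : 0 < p := zero_lt_one.trans_le hp
  calc eLpNorm overlap (ENNReal.ofReal p) (replicas μ)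
      ≤ ∑ i, eLpNorm (fun z : (Fin n → ℝ) × (Fin n → ℝ) => z.1 i * z.2 i)
          (ENNReal.ofReal p) (μ.prod μ) := by
        have hoverlap : overlap = ∑ i, fun z : (Fin n → ℝ) × (Fin n → ℝ) => z.1 i * z.2 i := by
          ext z
          simp [overlap]
        rw [hoverlap]
        exact eLpNorm_sum_le (fun i _ => by fun_prop) (by simpa using hp)
    _ = ∑ i : Fin n, eLpNorm (fun x : Fin n → ℝ => x i) (ENNReal.ofReal p) μ ^ 2 := by
        refine Finset.sum_congr rfl fun i _ => ?_
        have hi : AEMeasurable (fun x : Fin n → ℝ => x i) μ := (measurable_pi_apply i).aemeasurable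
        rw [eLpNorm_fst_mul_snd hi hi (by simpa using hp0) ENNReal.ofReal_ne_top, sq]
    _ ≤ ∑ _i : Fin n, ENNReal.ofReal (K * p ^ (1 / φ)) ^ 2 := by
        gcongr with i
        exact h i p hp
    _ = ENNReal.ofReal (n * K ^ 2 * p ^ (1 / (φ / 2))) := by
        have hexp : p ^ (1 / (φ / 2)) = (p ^ (1 / φ)) ^ 2 := by
          rw [← Real.rpow_mul_natCast hp0.le]
          congr 1
          push_cast
          ring
        rw [Finset.sum_const, Finset.card_univ, Fintype.card_fin, nsmul_eq_mul,
          ← ENNReal.ofReal_pow (by positivity), ← ENNReal.ofReal_natCast,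
          ← ENNReal.ofReal_mul n.cast_nonneg, hexp]
        ring_nf

end SubWeibull

theorem AllMoments.integral_abs_pow_le_add_sqrt {Ω : Type*} [MeasurableSpace Ω] {ν : Measure Ω}
    [IsProbabilityMeasure ν] {f : Ω → ℝ} (hf : AllMoments f ν) (hmeas : Measurable f) {q : ℝ}
    (hq : 0 ≤ q) (k : ℕ) :
    ∫ ω, |f ω| ^ k ∂ν ≤
      q ^ k + √((∫ ω, |f ω| ^ (2 * k) ∂ν) * ν.real {ω | q < |f ω|}) := by
  set E : Set Ω := {ω | q < |f ω|}
  have hE : MeasurableSet E := measurableSet_lt measurable_const hmeas.abs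
  have hind : MemLp (E.indicator fun _ => (1 : ℝ)) 2 ν := (memLp_const 1).indicator hE
  have hpow : AllMoments (fun ω => |f ω| ^ k) ν := hf.abs.pow k
  have hpointwise : ∀ ω, |f ω| ^ k ≤ q ^ k + |f ω| ^ k * E.indicator (fun _ => 1) ω := fun ω => by
    by_cases hω : ω ∈ E
    · simpa [hω] using pow_nonneg hq k
    · simpa [hω] using pow_le_pow_left₀ (abs_nonneg _) (not_lt.1 hω) k
  have htail : Integrable (fun ω => |f ω| ^ k * E.indicator (fun _ => 1) ω) ν :=
    hpow.memLp_two.integrable_mul hind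
  have hindsq : ∫ ω, (E.indicator (fun _ => (1 : ℝ)) ω) ^ 2 ∂ν = ν.real E := by
    have hsq : ∀ ω, (E.indicator (fun _ => (1 : ℝ)) ω) ^ 2 = E.indicator 1 ω := fun ω => by
      by_cases hω : ω ∈ E <;> simp [hω]
    simp only [hsq, integral_indicator_one hE]
  calc ∫ ω, |f ω| ^ k ∂ν
      ≤ ∫ ω, q ^ k + |f ω| ^ k * E.indicator (fun _ => 1) ω ∂ν :=
        integral_mono hpow.integrable ((integrable_const _).add htail) hpointwise
    _ = q ^ k + ∫ ω, |f ω| ^ k * E.indicator (fun _ => 1) ω ∂ν := by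
        rw [integral_add (integrable_const _) htail]
        simp
    _ ≤ q ^ k + √((∫ ω, |f ω| ^ (2 * k) ∂ν) * ν.real E) := by
        gcongr
        refine Real.le_sqrt_of_sq_le ((sq_integral_mul_le hpow.memLp_two hind).trans_eq ?_)
        simp only [hindsq, ← pow_mul, mul_comm k 2]

section FranzParisi

variable {n : ℕ} {μ : Measure (Fin n → ℝ)}

theorem annealedFP_eq (lam : ℝ) {t : ℝ} (ht : t ∈ overlapSupport μ) :
    annealedFP μ lam t = -(lam * t) - Real.log (overlapPMF μ t) := by
  have hmeas : MeasurableSet {z : (Fin n → ℝ) × (Fin n → ℝ) | overlap z = t} :=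
    measurableSet_eq_fun measurable_overlap measurable_const
  have hconst : Set.indicator {z : (Fin n → ℝ) × (Fin n → ℝ) | overlap z = t}
      (fun z => Real.exp (lam * overlap z)) =
      Set.indicator {z | overlap z = t} (fun _ => Real.exp (lam * t)) :=
    Set.indicator_congr fun z hz => by rw [show overlap z = t from hz]
  have hpos : 0 < overlapPMF μ t := ht
  rw [annealedFP, hconst, integral_indicator_const _ hmeas, smul_eq_mul, ← overlapPMF,
    Real.log_mul hpos.ne' (Real.exp_pos _).ne', Real.log_exp]
  ring

theorem add_discreteDeriv_annealedFP (lam : ℝ) {a : ℝ → ℝ} {t : ℝ} (ha : a t ≠ 0)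
    (ht : t ∈ overlapSupport μ) (hta : t + a t ∈ overlapSupport μ) :
    lam + discreteDeriv a (annealedFP μ lam) t =
      -discreteDeriv a (fun s => Real.log (overlapPMF μ s)) t := by
  rw [discreteDeriv, discreteDeriv, annealedFP_eq lam ht, annealedFP_eq lam hta]
  field_simp
  ring

theorem one_div_mul_add_discreteDeriv_annealedFP_le {a : ℝ → ℝ} {A r t : ℝ} (hA : 0 < A)
    (ht : t ∈ overlapSupport μ) (ha : a t ≠ 0) (hta : t + a t ∈ overlapSupport μ)
    (hstab : -(A / r) ≤ discreteDeriv a (fun s => Real.log (overlapPMF μ s)) t) (lam : ℝ) :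
    1 / A * (lam + discreteDeriv a (annealedFP μ lam) t) ≤ 1 / r := by
  rw [add_discreteDeriv_annealedFP lam ha ht hta, one_div_mul_eq_div, div_le_iff₀ hA,
    one_div_mul_eq_div]
  exact neg_le.1 hstab

end FranzParisi

section LowDegree

variable {n D : ℕ} {μ : Measure (Fin n → ℝ)} [IsProbabilityMeasure μ] {φ K R T : ℝ}

theorem integral_overlap_pow_le_of_isSubWeibull (hφ : 0 < φ) (hK : 0 ≤ K)
    (hW : ∀ i : Fin n, IsSubWeibull φ K (fun x => x i) μ) (hR : 1 ≤ R)
    (hKR : n * K ^ 2 * (2 * (D + 1)) ^ (2 / φ) ≤ R * quantile μ T)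
    (hRT : R ^ (D + 1) * Real.exp (-T / 2) ≤ 1 / 10) {m : ℕ} (hm : m ≤ D + 1) :
    ∫ z, overlap z ^ m ∂(replicas μ) ≤ 11 / 10 * quantile μ T ^ m := by
  rcases Nat.eq_zero_or_pos m with rfl | hm0
  · norm_num
  set q := quantile μ T
  have hR0 : 0 < R := one_pos.trans_le hR
  have hq0 : 0 ≤ q := nonneg_of_mul_nonneg_right (le_trans (by positivity) hKR) hR0
  have hover : AllMoments overlap (replicas μ) :=
    allMoments_overlap fun i => (hW i).allMoments (measurable_pi_apply i)
  have hmom : ∫ z, |overlap z| ^ (2 * m) ∂(replicas μ) ≤ (R * q) ^ (2 * m) := by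
    refine ((isSubWeibull_overlap hK hW).integral_abs_pow_le (by positivity) measurable_overlap
      (by lia)).trans (pow_le_pow_left₀ (by positivity) (le_trans ?_ hKR) _)
    rw [one_div_div]
    gcongr
    exact_mod_cast Nat.mul_le_mul_left 2 hm
  calc ∫ z, overlap z ^ m ∂(replicas μ)
      ≤ ∫ z, |overlap z| ^ m ∂(replicas μ) :=
        integral_mono (hover.pow m).integrable (hover.abs.pow m).integrable fun z =>
          (le_abs_self _).trans_eq (abs_pow _ _)
    _ ≤ q ^ m + √((∫ z, |overlap z| ^ (2 * m) ∂(replicas μ)) *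
          (replicas μ).real {z | q < |overlap z|}) :=
        hover.integral_abs_pow_le_add_sqrt measurable_overlap hq0 m
    _ ≤ q ^ m + √((R * q) ^ (2 * m) * Real.exp (-T)) := by
        gcongr
        exact measureReal_quantile_lt_le T
    _ = q ^ m + R ^ m * Real.exp (-T / 2) * q ^ m := by
        rw [Real.sqrt_mul (by positivity), mul_comm 2 m, pow_mul, Real.sqrt_sq (by positivity),
          ← Real.exp_half]
        ring
    _ ≤ q ^ m + 1 / 10 * q ^ m := by
        gcongr
        refine le_trans ?_ hRT
        gcongr
    _ = 11 / 10 * q ^ m := by ring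

theorem corr_sq_le_two_mul_quantile (hφ : 0 < φ) (hK : 0 ≤ K)
    (hW : ∀ i : Fin n, IsSubWeibull φ K (fun x => x i) μ)
    (hκ : ∀ α : Fin n → ℕ, ∑ i, α i ≤ D → 0 ≤ cumulant μ α) (hR : 1 ≤ R)
    (hKR : n * K ^ 2 * (2 * (D + 1)) ^ (2 / φ) ≤ R * quantile μ T)
    (hRT : R ^ (D + 1) * Real.exp (-T / 2) ≤ 1 / 10) {lam : ℝ} (hlam : 0 ≤ lam)
    (hlamq : lam * quantile μ T ≤ 1 / 16) :
    corr μ D lam ^ 2 ≤ 2 * quantile μ T := by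
  have hq0 : 0 ≤ quantile μ T :=
    nonneg_of_mul_nonneg_right (le_trans (by positivity) hKR) (one_pos.trans_le hR)
  have hexp : Real.exp (4 * lam * quantile μ T) ≤ 4 / 3 := by
    calc Real.exp (4 * lam * quantile μ T) ≤ Real.exp (1 / 4) := by gcongr; linarith
      _ ≤ 1 / (1 - 1 / 4) :=
        Real.exp_bound_div_one_sub_of_interval (by norm_num) (by norm_num)
      _ = 4 / 3 := by norm_num
  calc corr μ D lam ^ 2
      ≤ (11 / 10) ^ 2 * quantile μ T * Real.exp (4 * lam * quantile μ T) :=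
        corr_sq_le_of_overlap_moments (fun i => (hW i).allMoments (measurable_pi_apply i)) hκ hq0
          (by norm_num)
          (fun _ hm => integral_overlap_pow_le_of_isSubWeibull hφ hK hW hR hKR hRT hm) hlam
    _ ≤ (11 / 10) ^ 2 * quantile μ T * (4 / 3) := by gcongr
    _ ≤ 2 * quantile μ T := by linarith

end LowDegree

section Asymptotics

theorem tendsto_log_natCast_atTop : Tendsto (fun n : ℕ => Real.log n) atTop atTop :=
  Real.tendsto_log_atTop.comp tendsto_natCast_atTop_atTop

theorem eventually_subWeibull_bound_le {φ : ℝ} (hφ : 0 < φ) (K C : ℝ) :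
    ∀ᶠ n : ℕ in atTop, ∀ D : ℕ, 0 < D → (D : ℝ) ≤ (n : ℝ) ^ C →
      n * K ^ 2 * (2 * (D + 1)) ^ (2 / φ) ≤ (n : ℝ) ^ (2 + C * (2 / φ)) := by
  filter_upwards [eventually_gt_atTop 0,
    tendsto_natCast_atTop_atTop.eventually_ge_atTop (K ^ 2 * (4 : ℝ) ^ (2 / φ))]
    with n hn hKn D hD hDC
  have hn0 : (0 : ℝ) < n := Nat.cast_pos.2 hn
  have hD1 : (1 : ℝ) ≤ D := Nat.one_le_cast.2 hD
  calc (n : ℝ) * K ^ 2 * (2 * (D + 1)) ^ (2 / φ)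
      ≤ n * K ^ 2 * (4 * (n : ℝ) ^ C) ^ (2 / φ) := by
        refine mul_le_mul_of_nonneg_left ?_ (by positivity)
        refine Real.rpow_le_rpow (by positivity) ?_ (by positivity)
        linarith
    _ = n * (K ^ 2 * 4 ^ (2 / φ)) * (n : ℝ) ^ (C * (2 / φ)) := by
        rw [Real.mul_rpow (by positivity) (by positivity), ← Real.rpow_mul hn0.le]
        ring
    _ ≤ n * n * (n : ℝ) ^ (C * (2 / φ)) := by gcongr
    _ = (n : ℝ) ^ (2 + C * (2 / φ)) := by rw [Real.rpow_add hn0, Real.rpow_two, sq]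

theorem eventually_rpow_pow_mul_exp_le {e c : ℝ} (he : 0 ≤ e) (hc : 0 < c) :
    ∀ᶠ n : ℕ in atTop, ∀ D : ℕ, 0 < D → ∀ T : ℝ, c * (D * Real.log n ^ 2) ≤ T →
      ((n : ℝ) ^ e) ^ (D + 1) * Real.exp (-T / 2) ≤ 1 / 10 := by
  filter_upwards [eventually_ge_atTop 10,
    tendsto_log_natCast_atTop.eventually_ge_atTop ((1 + 2 * e) / (c / 2))]
    with n hn hlog D hD T hT
  have hn0 : (0 : ℝ) < n := Nat.cast_pos.2 (by lia)
  have hD1 : (1 : ℝ) ≤ D := Nat.one_le_cast.2 hD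
  set L := Real.log n
  have hL0 : 0 ≤ L := Real.log_nonneg (Nat.one_le_cast.2 (by lia))
  have hexponent : L * e * (D + 1) + -T / 2 ≤ -L := by
    have hDL : L * D * (1 + 2 * e) ≤ L * D * (L * (c / 2)) := by
      gcongr
      exact (div_le_iff₀ (by positivity)).1 hlog
    have hLe : L * e ≤ L * e * D := le_mul_of_one_le_right (by positivity) hD1
    have hLD : L ≤ L * D := le_mul_of_one_le_right hL0 hD1
    linarith
  calc ((n : ℝ) ^ e) ^ (D + 1) * Real.exp (-T / 2)
      = Real.exp (L * e * (D + 1) + -T / 2) := by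
        rw [Real.exp_add, Real.rpow_def_of_pos hn0, ← Real.exp_nat_mul, mul_comm (L * e)]
        push_cast
        rfl
    _ ≤ Real.exp (-L) := Real.exp_le_exp.2 hexponent
    _ = 1 / n := by rw [Real.exp_neg, Real.exp_log hn0, one_div]
    _ ≤ 1 / 10 := by
        gcongr
        exact_mod_cast hn

theorem rpow_neg_max_le_apply_min {f : ℝ → ℝ} {x s t a b : ℝ} (hx : 1 ≤ x)
    (ha : x ^ (-s) ≤ f a) (hb : x ^ (-t) ≤ f b) : x ^ (-max s t) ≤ f (min a b) := by
  rcases min_choice a b with h | h <;> rw [h]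
  · exact (Real.rpow_le_rpow_of_exponent_le hx (neg_le_neg (le_max_left s t))).trans ha
  · exact (Real.rpow_le_rpow_of_exponent_le hx (neg_le_neg (le_max_right s t))).trans hb

theorem exists_mul_le_min_of_isBigO {α : Type*} {l : Filter α} {f g : α → ℝ} (hf : ∀ x, 0 ≤ f x)
    (hg : ∀ᶠ x in l, 0 ≤ g x) (h : f =O[l] g) :
    ∃ c > 0, ∀ᶠ x in l, c * f x ≤ min (g x) (f x) := by
  obtain ⟨C, hC, hfg⟩ := h.exists_pos
  refine ⟨min C⁻¹ 1, lt_min (inv_pos.2 hC) one_pos, ?_⟩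
  filter_upwards [hfg.bound, hg] with x hx hgx
  rw [Real.norm_of_nonneg (hf x), Real.norm_of_nonneg hgx] at hx
  refine le_min ?_ (mul_le_of_le_one_left (hf x) (min_le_right _ _))
  exact (mul_le_mul_of_nonneg_right (min_le_left _ _) (hf x)).trans ((inv_mul_le_iff₀ hC).2 hx)

variable {μ : (n : ℕ) → Measure (Fin n → ℝ)} [∀ n, IsProbabilityMeasure (μ n)]
  {D : ℕ → ℕ} {φ K C : ℝ}

theorem eventually_corr_sq_le_of_quantile_ge (hφ : 0 < φ) (hK : 0 ≤ K)
    (hW : ∀ᶠ n in atTop, ∀ i : Fin n, IsSubWeibull φ K (fun x : Fin n → ℝ => x i) (μ n))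
    (hκ : ∀ᶠ n in atTop, ∀ α : Fin n → ℕ, ∑ i, α i ≤ D n → 0 ≤ cumulant (μ n) α)
    (hD : ∀ᶠ n in atTop, 0 < D n) (hDC : ∀ᶠ n : ℕ in atTop, (D n : ℝ) ≤ (n : ℝ) ^ C)
    {T : ℕ → ℝ} {c c' : ℝ} (hc : 0 < c)
    (hT : ∀ᶠ n : ℕ in atTop, c * (D n * Real.log n ^ 2) ≤ T n)
    (hqT : ∀ᶠ n : ℕ in atTop, (n : ℝ) ^ (-c') ≤ quantile (μ n) (T n)) :
    ∀ᶠ n in atTop, ∀ lam : ℝ, 0 ≤ lam → lam * quantile (μ n) (T n) ≤ 1 / 16 →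
      corr (μ n) (D n) lam ^ 2 ≤ 2 * quantile (μ n) (T n) := by
  set e := max 0 (2 + C * (2 / φ) + c')
  filter_upwards [hW, hκ, hD, hDC, hT, hqT, eventually_gt_atTop 0,
    eventually_subWeibull_bound_le hφ K C,
    eventually_rpow_pow_mul_exp_le (le_max_left _ _ : 0 ≤ e) hc]
    with n hW hκ hD hDC hT hqT hn hbound hexp lam hlam hlamq
  have hn1 : (1 : ℝ) ≤ n := Nat.one_le_cast.2 hn
  refine corr_sq_le_two_mul_quantile hφ hK hW hκ (Real.one_le_rpow hn1 (le_max_left _ _)) ?_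
    (hexp (D n) hD (T n) hT) hlam hlamq
  calc (n : ℝ) * K ^ 2 * (2 * (D n + 1)) ^ (2 / φ)
      ≤ (n : ℝ) ^ (2 + C * (2 / φ)) := hbound (D n) hD hDC
    _ = (n : ℝ) ^ (2 + C * (2 / φ) + c') * (n : ℝ) ^ (-c') := by
        rw [← Real.rpow_add (by positivity), add_neg_cancel_right]
    _ ≤ (n : ℝ) ^ e * quantile (μ n) (T n) := by
        gcongr
        exact le_max_right _ _

theorem eventually_corr_sq_le_of_isBigO (hφ : 0 < φ) (hK : 0 ≤ K)
    (hW : ∀ᶠ n in atTop, ∀ i : Fin n, IsSubWeibull φ K (fun x : Fin n → ℝ => x i) (μ n))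
    (hκ : ∀ᶠ n in atTop, ∀ α : Fin n → ℕ, ∑ i, α i ≤ D n → 0 ≤ cumulant (μ n) α)
    (hD : ∀ᶠ n in atTop, 0 < D n) (hDC : ∀ᶠ n : ℕ in atTop, (D n : ℝ) ≤ (n : ℝ) ^ C)
    {C₁ C₂ : ℝ}
    (hq : ∀ᶠ n : ℕ in atTop, (n : ℝ) ^ (-C₁) ≤ quantile (μ n) (D n * Real.log n ^ 2))
    {D' : ℕ → ℝ} (hD'_pos : ∀ᶠ n in atTop, 0 < D' n)
    (hD' : (fun n : ℕ => (D n : ℝ) * Real.log n ^ 2) =O[atTop] D')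
    (hqD' : ∀ᶠ n : ℕ in atTop, (n : ℝ) ^ (-C₂) ≤ quantile (μ n) (D' n)) :
    ∀ᶠ n : ℕ in atTop, ∀ lam : ℝ, 0 ≤ lam →
      lam ≤ 1 / (quantile (μ n) (D n * Real.log n ^ 2) * Real.log n) →
      corr (μ n) (D n) lam ^ 2 ≤ 2 * quantile (μ n) (D' n) := by
  obtain ⟨c, hc, hT⟩ := exists_mul_le_min_of_isBigO (fun n => by positivity)
    (hD'_pos.mono fun _ => le_of_lt) hD'
  set T : ℕ → ℝ := fun n => min (D' n) (D n * Real.log n ^ 2)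
  have hqT : ∀ᶠ n : ℕ in atTop, (n : ℝ) ^ (-max C₂ C₁) ≤ quantile (μ n) (T n) := by
    filter_upwards [hq, hqD', eventually_gt_atTop 0] with n hq hqD' hn
    exact rpow_neg_max_le_apply_min (Nat.one_le_cast.2 hn) hqD' hq
  filter_upwards [eventually_corr_sq_le_of_quantile_ge hφ hK hW hκ hD hDC hc hT hqT, hq, hqT, hD,
    hD'_pos, tendsto_log_natCast_atTop.eventually_ge_atTop 16, eventually_gt_atTop 0]
    with n hcorr hq hqT hD hD'_pos hlog hn lam hlam hle
  have hn0 : (0 : ℝ) < n := Nat.cast_pos.2 hn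
  have hT0 : 0 < T n := lt_min hD'_pos (by positivity)
  have hq0 := (Real.rpow_pos_of_pos hn0 _).trans_le hq
  have hqS : quantile (μ n) (T n) ≤ quantile (μ n) (D n * Real.log n ^ 2) :=
    quantile_mono hT0 (min_le_right _ _)
  have hlamq : lam * quantile (μ n) (T n) ≤ 1 / 16 := by
    calc lam * quantile (μ n) (T n)
        ≤ 1 / (quantile (μ n) (D n * Real.log n ^ 2) * Real.log n) *
            quantile (μ n) (D n * Real.log n ^ 2) := by
          gcongr
          exact (Real.rpow_pos_of_pos hn0 _).le.trans hqT
      _ = 1 / Real.log n := by field_simp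
      _ ≤ 1 / 16 := by gcongr
  calc corr (μ n) (D n) lam ^ 2 ≤ 2 * quantile (μ n) (T n) := hcorr lam hlam hlamq
    _ ≤ 2 * quantile (μ n) (D' n) := by
        gcongr
        exact quantile_mono hT0 (min_le_left _ _)

end Asymptotics

end

end GAM

theorem theorem2p8_general
    {μ : (n : ℕ) → Measure (Fin n → ℝ)} [∀ n, IsProbabilityMeasure (μ n)]
    {D : ℕ → ℕ} {D' A : ℕ → ℝ} {a : ℕ → ℝ → ℝ} {φ K C C₁ C₂ : ℝ} (hφ : 0 < φ) (hK : 0 ≤ K)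
    (hW : ∀ᶠ n in atTop, ∀ i, GAM.IsSubWeibull φ K (fun x => x i) (μ n))
    (hκ : ∀ᶠ n in atTop, ∀ α : Fin n → ℕ, ∑ i, α i ≤ D n → 0 ≤ GAM.cumulant (μ n) α)
    (hD : ∀ᶠ n in atTop, 0 < D n) (hDC : ∀ᶠ n : ℕ in atTop, (D n : ℝ) ≤ (n : ℝ) ^ C)
    (hA : ∀ᶠ n in atTop, 0 < A n)
    (hstep : ∀ᶠ n in atTop, GAM.quantile (μ n) (D n) ∈ GAM.overlapSupport (μ n) ∧
      a n (GAM.quantile (μ n) (D n)) ≠ 0 ∧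
      GAM.quantile (μ n) (D n) + a n (GAM.quantile (μ n) (D n)) ∈ GAM.overlapSupport (μ n))
    (hstab : ∀ᶠ n : ℕ in atTop,
      -(A n / (GAM.quantile (μ n) (D n * Real.log n ^ 2) * Real.log n)) ≤
        GAM.discreteDeriv (a n) (fun t => Real.log (GAM.overlapPMF (μ n) t))
          (GAM.quantile (μ n) (D n)))
    (hq : ∀ᶠ n : ℕ in atTop, (n : ℝ) ^ (-C₁) ≤ GAM.quantile (μ n) (D n * Real.log n ^ 2))
    (hD'_pos : ∀ᶠ n in atTop, 0 < D' n)
    (hD' : (fun n : ℕ => (D n : ℝ) * Real.log n ^ 2) =O[atTop] D')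
    (hqD' : ∀ᶠ n : ℕ in atTop, (n : ℝ) ^ (-C₂) ≤ GAM.quantile (μ n) (D' n)) :
    (∀ᶠ n in atTop, ∀ u : ℝ,
      0 ≤ u + GAM.discreteDeriv (a n) (GAM.annealedFP (μ n) u) (GAM.quantile (μ n) (D n)) →
      GAM.corr (μ n) (D n) (1 / A n *
        (u + GAM.discreteDeriv (a n) (GAM.annealedFP (μ n) u) (GAM.quantile (μ n) (D n)))) ^ 2
        ≤ 2 * GAM.quantile (μ n) (D' n)) ∧
    (∀ᶠ n in atTop, ∀ lam : ℝ, 0 ≤ lam →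
      0 ≤ GAM.discreteDeriv (a n) (GAM.annealedFP (μ n) lam) (GAM.quantile (μ n) (D n)) →
      GAM.corr (μ n) (D n) (1 / A n * lam) ^ 2 ≤ 2 * GAM.quantile (μ n) (D' n)) := by
  have hcorr := GAM.eventually_corr_sq_le_of_isBigO hφ hK hW hκ hD hDC hq hD'_pos hD' hqD'
  have hadmissible : ∀ᶠ n : ℕ in atTop, ∀ u : ℝ,
      1 / A n *
        (u + GAM.discreteDeriv (a n) (GAM.annealedFP (μ n) u) (GAM.quantile (μ n) (D n))) ≤
      1 / (GAM.quantile (μ n) (D n * Real.log n ^ 2) * Real.log n) := by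
    filter_upwards [hA, hstep, hstab] with n hA ⟨ht, ha, hta⟩ hstab
    exact GAM.one_div_mul_add_discreteDeriv_annealedFP_le hA ht ha hta hstab
  constructor
  · filter_upwards [hA, hcorr, hadmissible] with n hA hcorr hadmissible u hu
    exact hcorr _ (by positivity) (hadmissible u)
  · filter_upwards [hA, hcorr, hadmissible] with n hA hcorr hadmissible lam hlam hΔ
    refine hcorr _ (by positivity) (le_trans ?_ (hadmissible lam))
    gcongr
    exact le_add_of_nonneg_right hΔ

theorem theorem2p8
    (P : (n : ℕ) → PMF (Fin n → ℝ)) (D D' : ℕ → ℕ) (A : ℕ → ℝ) (a : ℕ → ℝ → ℝ) (C : ℝ)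
    (hP : GAM.CumulantNonneg P D A a C)
    (hD'_pos : ∀ n, 0 < D' n)
    (hD' : (fun n : ℕ => (D' n : ℝ)) ~[atTop] (fun n : ℕ => (D n : ℝ) * Real.log n ^ 2))
    (hqD' : ∃ C₂ : ℝ, 0 < C₂ ∧ ∀ᶠ n : ℕ in atTop,
      (n : ℝ) ^ (-C₂) ≤ GAM.quantile (P n).toMeasure (D' n)) :
    (∀ᶠ n : ℕ in atTop, ∀ u : ℝ, 0 < u →
      0 < u + GAM.discreteDeriv (a n) (GAM.annealedFP (P n).toMeasure u)
        (GAM.quantile (P n).toMeasure (D n)) →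
      GAM.corr (P n).toMeasure (D n)
        (1 / A n * (u + GAM.discreteDeriv (a n) (GAM.annealedFP (P n).toMeasure u)
          (GAM.quantile (P n).toMeasure (D n)))) ^ 2
        ≤ 2 * GAM.quantile (P n).toMeasure (D' n)) ∧
    (∀ᶠ n : ℕ in atTop, ∀ lam : ℝ, 0 < lam →
      0 ≤ GAM.discreteDeriv (a n) (GAM.annealedFP (P n).toMeasure lam)
        (GAM.quantile (P n).toMeasure (D n)) →
      GAM.corr (P n).toMeasure (D n) (1 / A n * lam) ^ 2
        ≤ 2 * GAM.quantile (P n).toMeasure (D' n)) := by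
  obtain ⟨φ, hφ, K, hK, hW⟩ := hP.subWeibull
  obtain ⟨C₁, -, hq⟩ := hP.quantile_decay
  obtain ⟨C₂, -, hqD'⟩ := hqD'
  obtain ⟨hshifted, hmonotone⟩ := theorem2p8_general hφ hK.le hW hP.cumulant_nonneg
    (.of_forall hP.D_pos) hP.D_le (.of_forall hP.A_pos)
    (hP.step.mono fun _ ⟨ht, ha, hta⟩ => ⟨ht, ha.ne', hta⟩) hP.quantile_stability
    (hq.mono fun _ => (le_max_right _ _).trans)
    (.of_forall fun n => Nat.cast_pos.2 (hD'_pos n)) hD'.isBigO_symm hqD'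
  exact ⟨hshifted.mono fun _ hn u _ hu => hn u hu.le,
    hmonotone.mono fun _ hn lam hlam => hn lam hlam.le⟩
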